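/- Let $\mathscr A$ be an alphabet, $F\subseteq\mathscr A^*$ a set of words, and let $X=X_F\subseteq\mathscr A^{\mathbb N}$ be the subshift of all sequences in which no word of $F$ occurs; assume that, unless $X=\emptyset$, every letter of $\mathscr A$ occurs in some element of $X$. Let $R$ be a field. Let $\mathcal L_X$ be the language of $X$ (the set of finite words occurring in elements of $X$), let $C(\alpha,\beta)=\{\beta x\in X:\alpha x\in X\}$ for $\alpha,\beta\in\mathcal L_X$, and let $\mathcal U$ be the Boolean algebra of subsets of $X$ generated by the sets $C(\alpha,\beta)$. The unital subshift algebra $\widetilde{\mathcal A}_R(X)$ is the universal unital $R$-algebra generated by $\{p_A:A\in\mathcal U\}\cup\{s_a,s_a^*:a\in\mathscr A\}$ subject to (i) $p_X=1$, $p_\emptyset=0$, $p_{A\cap B}=p_Ap_B$, $p_{A\cup B}=p_A+p_B-p_{A\cap B}$ for $A,B\in\mathcal U$; (ii) $s_as_a^*s_a=s_a$ and $s_a^*s_as_a^*=s_a^*$ for $a\in\mathscr A$; (iii) $s_\beta s_\alpha^*s_\alpha s_\beta^*=p_{C(\alpha,\beta)}$ for $\alpha,\beta\in\mathcal L_X$,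 where $s_{\alpha_1\cdots\alpha_n}=s_{\alpha_1}\cdots s_{\alpha_n}$, $s_{\alpha_1\cdots\alpha_n}^*=s_{\alpha_n}^*\cdots s_{\alpha_1}^*$, and both are $1$ for the empty word. Let $\sigma$ denote the shift, and write $x\sim y$ if $\sigma^m(x)=\sigma^n(y)$ for some $m,n\in\mathbb N$. An irrational path of $X$ is a point $q\in X$ such that $\{q\}\in\mathcal U$ and $q\neq\alpha\beta^\infty$ for all $\alpha,\beta\in\mathcal L_X$ with $\beta$ non-empty. Let $\mathcal Q_X$ be the set of irrational paths, and let $\langle z\rangle$ be the two-sided ideal of $\widetilde{\mathcal A}_R(X)$ generated by $z$. (1) For all $x,y\in X$ with $\{x\},\{y\}\in\mathcal U$: if $x\sim y$, then $\langle p_{\{x\}}\rangle=\langle p_{\{y\}}\rangle$; if $x\not\sim y$, then $\langle p_{\{x\}}\rangle\langle p_{\{y\}}\rangle=0$. In particular, for $[q]\in\mathcal Q_X/\sim$, the ideal $\langle p_{[q]}\rangle:=\langle p_{\{q'\}}\rangle$ does not depend on the choice of $q'\in[q]$. (2) The socle of $\widetilde{\mathcal A}_R(X)$, that is, the sum of all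 its minimal left ideals, is the internal direct sum $$\operatorname{Soc}\bigl(\widetilde{\mathcal A}_R(X)\bigr)=\bigoplus_{[q]\in\mathcal Q_X/\sim}\langle p_{[q]}\rangle .$$ -/

import Mathlib

noncomputable section

namespace SubshiftAlgebra

universe u v

variable {𝓐 : Type u}

/-- The subshift `X_F`: all sequences over `𝓐` in which no finite word of `F` occurs. -/
def subshift (F : Set (List 𝓐)) : Set (Stream' 𝓐) :=
  {x | ∀ m n : ℕ, (x.drop m).take n ∉ F}

/-- The language of `X`: all words `x₀ ⋯ xₙ₋₁` with `x ∈ X` and `n ∈ ℕ`. -/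
def language (X : Set (Stream' 𝓐)) : Set (List 𝓐) :=
  {w | ∃ x ∈ X, ∃ n : ℕ, x.take n = w}

/-- `C(α, β) = {β x ∈ X : α x ∈ X}`, as a subset of `X`. -/
def cylFol (X : Set (Stream' 𝓐)) (α β : List 𝓐) : Set X :=
  {y | ∃ x : Stream' 𝓐, (y : Stream' 𝓐) = β ++ₛ x ∧ α ++ₛ x ∈ X}

/-- The Boolean algebra `𝓤` of subsets of `X` generated by all `C(α, β)` with `α, β` in the
language of `X`. -/
def boolAlg (X : Set (Stream' 𝓐)) : BooleanSubalgebra (Set X) :=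
  BooleanSubalgebra.closure
    {A | ∃ α ∈ language X, ∃ β ∈ language X, A = cylFol X α β}

theorem cylFol_mem (X : Set (Stream' 𝓐)) {α β : List 𝓐} (hα : α ∈ language X)
    (hβ : β ∈ language X) : cylFol X α β ∈ boolAlg X :=
  BooleanSubalgebra.subset_closure ⟨α, hα, β, hβ, rfl⟩

/-- The generators of the unital subshift algebra: `p_A` for `A ∈ 𝓤`, and `s_a`, `s_a^*` for
`a ∈ 𝓐`. -/
inductive Gen (X : Set (Stream' 𝓐)) : Type u
  | p (A : boolAlg X)
  | s (a : 𝓐)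
  | sStar (a : 𝓐)

section Algebra

variable (R : Type v) [CommRing R] (X : Set (Stream' 𝓐))

/-- The free unital `R`-algebra on the generators. -/
abbrev Free : Type (max u v) := FreeAlgebra R (Gen X)

/-- The generator `p_A` in the free algebra. -/
def fp (A : boolAlg X) : Free R X := FreeAlgebra.ι R (Gen.p A)

/-- The generator `s_a` in the free algebra. -/
def fs (a : 𝓐) : Free R X := FreeAlgebra.ι R (Gen.s a)

/-- The generator `s_a^*` in the free algebra. -/
def fsStar (a : 𝓐) : Free R X := FreeAlgebra.ι R (Gen.sStar a)

/-- `s_α = s_{α₁} ⋯ s_{αₙ}`, with `s_ω = 1` for the empty word `ω`. -/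
def fsWord (α : List 𝓐) : Free R X := (α.map (fs R X)).prod

/-- `s_α^* = s_{αₙ}^* ⋯ s_{α₁}^*`, with `s_ω^* = 1` for the empty word `ω`. -/
def fsStarWord (α : List 𝓐) : Free R X := (α.reverse.map (fsStar R X)).prod

/-- The defining relations of the unital subshift algebra. -/
inductive Rel : Free R X → Free R X → Prop
  | p_top : Rel (fp R X ⊤) 1
  | p_inf (A B : boolAlg X) : Rel (fp R X (A ⊓ B)) (fp R X A * fp R X B)
  | p_sup (A B : boolAlg X) :
      Rel (fp R X (A ⊔ B)) (fp R X A + fp R X B - fp R X (A ⊓ B))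
  | p_bot : Rel (fp R X ⊥) 0
  | s_sStar_s (a : 𝓐) : Rel (fs R X a * fsStar R X a * fs R X a) (fs R X a)
  | sStar_s_sStar (a : 𝓐) :
      Rel (fsStar R X a * fs R X a * fsStar R X a) (fsStar R X a)
  | word (α β : List 𝓐) (hα : α ∈ language X) (hβ : β ∈ language X) :
      Rel (fsWord R X β * fsStarWord R X α * fsWord R X α * fsStarWord R X β)
        (fp R X ⟨cylFol X α β, cylFol_mem X hα hβ⟩)

/-- The unital subshift algebra of `X` over `R`: the universal unital `R`-algebra on the
generators `p_A`, `s_a`, `s_a^*` subject to the relations `Rel`. -/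
abbrev Alg : Type (max u v) := RingQuot (Rel R X)

/-- The element `p_A` of the subshift algebra, for `A ∈ 𝓤`. -/
def proj (A : boolAlg X) : Alg R X := RingQuot.mkAlgHom R (Rel R X) (fp R X A)

end Algebra

/-- The left socle of a ring: the sum of all its minimal left ideals. -/
def socle (B : Type*) [Ring B] : Ideal B := sSup {I : Ideal B | IsAtom I}

/-- Tail equivalence: `σ^m x = σ^n y` for some `m, n`. -/
def TailEquiv (x y : Stream' 𝓐) : Prop := ∃ m n : ℕ, x.drop m = y.drop n

theorem tailEquiv_equivalence : Equivalence (TailEquiv (𝓐 := 𝓐)) where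
  refl x := ⟨0, 0, rfl⟩
  symm := fun ⟨m, n, h⟩ => ⟨n, m, h.symm⟩
  trans := by
    rintro x y z ⟨m, n, h⟩ ⟨k, l, h'⟩
    refine ⟨m + k, l + n, ?_⟩
    rw [← Stream'.drop_drop, h, Stream'.drop_drop, Nat.add_comm n k, ← Stream'.drop_drop, h',
      Stream'.drop_drop]

/-- The irrational paths of `X`: the points `p ∈ X` with `{p} ∈ 𝓤` such that `p ≠ α β^∞` for all
words `α, β` (with `β` non-empty) of the language of `X`. -/
def IrrationalPath (X : Set (Stream' 𝓐)) : Type u :=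
  {p : X // ({p} : Set X) ∈ boolAlg X ∧
    ∀ α ∈ language X, ∀ β ∈ language X, ∀ hβ : β ≠ [],
      (p : Stream' 𝓐) ≠ α ++ₛ Stream'.cycle β hβ}

/-- Tail equivalence on the irrational paths. -/
def tailSetoid (X : Set (Stream' 𝓐)) : Setoid (IrrationalPath X) where
  r p q := TailEquiv (p.1 : Stream' 𝓐) (q.1 : Stream' 𝓐)
  iseqv := ⟨fun _ => tailEquiv_equivalence.refl _, tailEquiv_equivalence.symm,
    tailEquiv_equivalence.trans⟩

/-- The set of tail equivalence classes of irrational paths. -/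
abbrev PathClass (X : Set (Stream' 𝓐)) : Type u := Quotient (tailSetoid X)

/-- The two-sided ideal `⟨p_{x}⟩` of the subshift algebra generated by `p_{x}`, for a point
`x` with `{x} ∈ 𝓤`. -/
def pointIdeal (R : Type v) [CommRing R] (X : Set (Stream' 𝓐)) (x : X)
    (hx : ({x} : Set X) ∈ boolAlg X) : TwoSidedIdeal (Alg R X) :=
  TwoSidedIdeal.span {proj R X ⟨{x}, hx⟩}

end SubshiftAlgebra

end

noncomputable section

namespace SubshiftAlgebra

universe u v

section

variable {𝓐 : Type u}

/-! ### Words and points -/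

/-! The algebra is spanned by the monomials `s_α p_A s_β^*`, because each projection moves past
`s_α` and `s_α^*` at the cost of replacing its set by a preimage (`mem_span_mon`). Multiplying a
monomial by the projection of an isolated point `y` gives either `0` or `s_α p_{x} s_β^*` with `y =
βx` and `αx ∈ X` (`mon_mul_pt`). So isolated points interact only within a tail class, where they
are linked by partial isometries. This gives part (1), and finite sums of point projections serve as
local left units, which make the ideals of distinct classes independent.

If `q` is isolated and not eventually periodic, only monomials with `α = β` survive in the corner at
`q`, so this corner is `R p_{q}`. As `R` is a field, every nonzero `u p_{q}` can be carried back to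
`p_{q}`, and `⟨p_{q}⟩` lies in the socle.

For the converse, take a nonzero `a` in a minimal left ideal. By `exists_reduction`, some `b a c` is
either a nonzero multiple of a projection `p_E`, or lies in the corner of an isolated point and has
a nonzero diagonal coefficient. Minimality is inherited by `b a c`. In the first case it forces `E`
to be a single point, since a cylinder would otherwise split `E`. It then excludes `x = αβ^∞`: a
representation on functions `X → R[T;T⁻¹]`, where `s_a` has weight `T` and `s_a^*` weight `T⁻¹`,
sends the loop `s_α s_β s_α^*` to `T^|β|` at `x`, and `1 - T^|β|` is not invertible. The same
representation shows that projections of nonempty sets are nonzero. -/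

/-- A shift-invariant nonempty set of sequences in which every letter occurs. -/
structure IsFull (X : Set (Stream' 𝓐)) : Prop where
  tail_mem : ∀ x ∈ X, x.tail ∈ X
  nil_mem : [] ∈ language X
  letter_mem : ∀ a : 𝓐, [a] ∈ language X

theorem mem_language_iff {X : Set (Stream' 𝓐)} {w : List 𝓐} :
    w ∈ language X ↔ ∃ z, w ++ₛ z ∈ X := by
  constructor
  · rintro ⟨x, hx, n, rfl⟩
    exact ⟨x.drop n, by rwa [Stream'.append_take_drop]⟩
  · rintro ⟨z, hz⟩
    refine ⟨_, hz, w.length, ?_⟩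
    rw [Stream'.take_append_of_le_length, List.take_length]
    exact le_rfl

theorem IsFull.of_append_mem {X : Set (Stream' 𝓐)} (hX : IsFull X) {α : List 𝓐} {z : Stream' 𝓐}
    (h : α ++ₛ z ∈ X) : z ∈ X := by
  induction α with
  | nil => exact h
  | cons a α ih => exact ih (hX.tail_mem _ h)

theorem IsFull.drop_mem {X : Set (Stream' 𝓐)} (hX : IsFull X) {x : Stream' 𝓐} (h : x ∈ X)
    (n : ℕ) : x.drop n ∈ X := by
  rw [← Stream'.append_take_drop n x] at h
  exact hX.of_append_mem h

theorem IsFull.language_of_append_right {X : Set (Stream' 𝓐)} (hX : IsFull X) {α β : List 𝓐}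
    (h : α ++ β ∈ language X) : β ∈ language X := by
  rw [mem_language_iff] at *
  obtain ⟨z, hz⟩ := h
  exact ⟨z, hX.of_append_mem (by rwa [← Stream'.append_append_stream])⟩

/-- The points `x` with `α x ∈ B`. -/
def pre (X : Set (Stream' 𝓐)) (α : List 𝓐) (B : Set X) : Set X :=
  {x | ∃ y ∈ B, (y : Stream' 𝓐) = α ++ₛ (x : Stream' 𝓐)}

/-- The points of `X` of the form `α x` with `x ∈ A`. -/
def img (X : Set (Stream' 𝓐)) (α : List 𝓐) (A : Set X) : Set X :=
  {y | ∃ x ∈ A, (y : Stream' 𝓐) = α ++ₛ (x : Stream' 𝓐)}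

section

variable {X : Set (Stream' 𝓐)}

@[simp] theorem pre_nil (B : Set X) : pre X [] B = B := by
  ext x
  simp [pre]

@[simp] theorem img_nil (B : Set X) : img X [] B = B := by
  ext x
  simp only [img, Stream'.nil_append_stream, Set.mem_ofPred_eq]
  constructor
  · rintro ⟨y, hy, h⟩
    rwa [Subtype.ext h]
  · exact fun h => ⟨x, h, rfl⟩

theorem pre_cons (hX : IsFull X) (a : 𝓐) (α : List 𝓐) (B : Set X) :
    pre X (a :: α) B = pre X α (pre X [a] B) := by
  ext x
  constructor
  · rintro ⟨y, hy, h⟩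
    have h' := y.2
    rw [h] at h'
    exact ⟨⟨α ++ₛ (x : Stream' 𝓐), hX.tail_mem _ h'⟩, ⟨y, hy, h⟩, rfl⟩
  · rintro ⟨z, ⟨y, hy, h⟩, h'⟩
    exact ⟨y, hy, by rw [h, h']; rfl⟩

theorem img_cons (hX : IsFull X) (a : 𝓐) (α : List 𝓐) (B : Set X) :
    img X (a :: α) B = img X [a] (img X α B) := by
  ext x
  constructor
  · rintro ⟨y, hy, h⟩
    have h' := x.2
    rw [h] at h'
    exact ⟨⟨α ++ₛ (y : Stream' 𝓐), hX.tail_mem _ h'⟩, ⟨y, hy, rfl⟩, h⟩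
  · rintro ⟨z, ⟨y, hy, h⟩, h'⟩
    exact ⟨y, hy, by rw [h', h]; rfl⟩

theorem mem_pre_singleton {α : List 𝓐} {x y : X} :
    x ∈ pre X α {y} ↔ (y : Stream' 𝓐) = α ++ₛ (x : Stream' 𝓐) := by
  simp [pre]

theorem mem_img_singleton {α : List 𝓐} {x y : X} :
    y ∈ img X α {x} ↔ (y : Stream' 𝓐) = α ++ₛ (x : Stream' 𝓐) := by
  simp [img]

theorem pre_eq_singleton {α : List 𝓐} {x y : X} (h : (y : Stream' 𝓐) = α ++ₛ (x : Stream' 𝓐)) :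
    pre X α {y} = {x} := by
  ext z
  rw [mem_pre_singleton, h, Stream'.append_right_inj, Set.mem_singleton_iff, Subtype.ext_iff,
    eq_comm]

theorem img_eq_singleton {α : List 𝓐} {x y : X} (h : (y : Stream' 𝓐) = α ++ₛ (x : Stream' 𝓐)) :
    img X α {x} = {y} := by
  ext z
  rw [mem_img_singleton, ← h, Set.mem_singleton_iff, Subtype.ext_iff]

end

theorem univ_mem_boolAlg (X : Set (Stream' 𝓐)) : (Set.univ : Set X) ∈ boolAlg X :=
  BooleanSubalgebra.top_mem

theorem empty_mem_boolAlg (X : Set (Stream' 𝓐)) : (∅ : Set X) ∈ boolAlg X :=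
  BooleanSubalgebra.bot_mem

theorem inter_mem_boolAlg {X : Set (Stream' 𝓐)} {A B : Set X} (hA : A ∈ boolAlg X)
    (hB : B ∈ boolAlg X) : A ∩ B ∈ boolAlg X :=
  BooleanSubalgebra.inf_mem hA hB

theorem union_mem_boolAlg {X : Set (Stream' 𝓐)} {A B : Set X} (hA : A ∈ boolAlg X)
    (hB : B ∈ boolAlg X) : A ∪ B ∈ boolAlg X :=
  BooleanSubalgebra.sup_mem hA hB

/-! ### Relations in the subshift algebra -/

section Algebra

variable (R : Type v) [CommRing R] (X : Set (Stream' 𝓐))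

open Classical in
/-- The element `p_A`, extended by `0` to all subsets of `X`. -/
def pp (A : Set X) : Alg R X := if h : A ∈ boolAlg X then proj R X ⟨A, h⟩ else 0

/-- The element `s_α`. -/
def ss (α : List 𝓐) : Alg R X := RingQuot.mkAlgHom R (Rel R X) (fsWord R X α)

/-- The element `s_α^*`. -/
def sd (α : List 𝓐) : Alg R X := RingQuot.mkAlgHom R (Rel R X) (fsStarWord R X α)

variable {R X}

theorem pp_of_mem {A : Set X} (h : A ∈ boolAlg X) : pp R X A = proj R X ⟨A, h⟩ := dif_pos h

theorem pp_univ : pp R X Set.univ = 1 := by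
  rw [pp_of_mem (univ_mem_boolAlg X)]
  exact (RingQuot.mkAlgHom_rel R (Rel.p_top (R := R) (X := X))).trans (map_one _)

theorem pp_empty : pp R X ∅ = 0 := by
  rw [pp_of_mem (empty_mem_boolAlg X)]
  exact (RingQuot.mkAlgHom_rel R (Rel.p_bot (R := R) (X := X))).trans (map_zero _)

theorem pp_inter {A B : Set X} (hA : A ∈ boolAlg X) (hB : B ∈ boolAlg X) :
    pp R X (A ∩ B) = pp R X A * pp R X B := by
  rw [pp_of_mem hA, pp_of_mem hB, pp_of_mem (inter_mem_boolAlg hA hB)]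
  exact (RingQuot.mkAlgHom_rel R (Rel.p_inf (R := R) (X := X) ⟨A, hA⟩ ⟨B, hB⟩)).trans
    (map_mul _ _ _)

theorem pp_union {A B : Set X} (hA : A ∈ boolAlg X) (hB : B ∈ boolAlg X) :
    pp R X (A ∪ B) = pp R X A + pp R X B - pp R X (A ∩ B) := by
  rw [pp_of_mem hA, pp_of_mem hB, pp_of_mem (inter_mem_boolAlg hA hB),
    pp_of_mem (union_mem_boolAlg hA hB)]
  refine (RingQuot.mkAlgHom_rel R (Rel.p_sup (R := R) (X := X) ⟨A, hA⟩ ⟨B, hB⟩)).trans ?_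
  rw [map_sub, map_add]
  rfl

theorem pp_comm {A B : Set X} (hA : A ∈ boolAlg X) (hB : B ∈ boolAlg X) :
    pp R X A * pp R X B = pp R X B * pp R X A := by
  rw [← pp_inter hA hB, ← pp_inter hB hA, Set.inter_comm]

theorem pp_idem {A : Set X} (hA : A ∈ boolAlg X) : pp R X A * pp R X A = pp R X A := by
  rw [← pp_inter hA hA, Set.inter_self]

theorem pp_compl {A : Set X} (hA : A ∈ boolAlg X) : pp R X Aᶜ = 1 - pp R X A := by
  have h := pp_union (R := R) hA (BooleanSubalgebra.compl_mem hA)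
  rw [Set.union_compl_self, Set.inter_compl_self, pp_univ, pp_empty, sub_zero] at h
  rw [h]
  abel

@[simp] theorem ss_nil : ss R X [] = 1 := by simp [ss, fsWord]

@[simp] theorem sd_nil : sd R X [] = 1 := by simp [sd, fsStarWord]

theorem ss_append (α β : List 𝓐) : ss R X (α ++ β) = ss R X α * ss R X β := by
  simp [ss, fsWord]

theorem sd_append (α β : List 𝓐) : sd R X (α ++ β) = sd R X β * sd R X α := by
  simp [sd, fsStarWord]

theorem ss_cons (a : 𝓐) (α : List 𝓐) : ss R X (a :: α) = ss R X [a] * ss R X α :=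
  ss_append [a] α

theorem sd_cons (a : 𝓐) (α : List 𝓐) : sd R X (a :: α) = sd R X α * sd R X [a] :=
  sd_append [a] α

theorem ss_sd_ss_letter (a : 𝓐) : ss R X [a] * sd R X [a] * ss R X [a] = ss R X [a] := by
  have h := RingQuot.mkAlgHom_rel R (Rel.s_sStar_s (R := R) (X := X) a)
  simpa [ss, sd, fsWord, fsStarWord] using h

theorem sd_ss_sd_letter (a : 𝓐) : sd R X [a] * ss R X [a] * sd R X [a] = sd R X [a] := by
  have h := RingQuot.mkAlgHom_rel R (Rel.sStar_s_sStar (R := R) (X := X) a)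
  simpa [ss, sd, fsWord, fsStarWord] using h

theorem word_rel {α β : List 𝓐} (hα : α ∈ language X) (hβ : β ∈ language X) :
    ss R X β * sd R X α * ss R X α * sd R X β = pp R X (cylFol X α β) := by
  rw [pp_of_mem (cylFol_mem X hα hβ)]
  have h := RingQuot.mkAlgHom_rel R (Rel.word (R := R) (X := X) α β hα hβ)
  rw [map_mul, map_mul, map_mul] at h
  exact h

variable (hX : IsFull X)
include hX

theorem cylFol_mem_nil_right {α : List 𝓐} (hα : α ∈ language X) : cylFol X α [] ∈ boolAlg X :=
  cylFol_mem X hα hX.nil_mem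

theorem cylFol_mem_nil_left {α : List 𝓐} (hα : α ∈ language X) : cylFol X [] α ∈ boolAlg X :=
  cylFol_mem X hX.nil_mem hα

theorem sd_ss_of_mem {α : List 𝓐} (hα : α ∈ language X) :
    sd R X α * ss R X α = pp R X (cylFol X α []) := by
  rw [← word_rel hα hX.nil_mem]
  simp

theorem ss_sd_of_mem {β : List 𝓐} (hβ : β ∈ language X) :
    ss R X β * sd R X β = pp R X (cylFol X [] β) := by
  rw [← word_rel hX.nil_mem hβ]
  simp

/-- The projections `p_B` move past the generator `s_a`. -/
theorem pre_letter (a : 𝓐) {B : Set X} (hB : B ∈ boolAlg X) :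
    pre X [a] B ∈ boolAlg X ∧ pp R X B * ss R X [a] = ss R X [a] * pp R X (pre X [a] B) := by
  have ha := hX.letter_mem a
  have hmem : ∀ x : X, (∃ y : X, (y : Stream' 𝓐) = [a] ++ₛ (x : Stream' 𝓐)) ↔
      x ∈ cylFol X [a] [] := by
    intro x
    constructor
    · rintro ⟨y, hy⟩
      exact ⟨x, rfl, hy ▸ y.2⟩
    · rintro ⟨z, hz, h⟩
      rw [Stream'.nil_append_stream] at hz
      exact ⟨⟨_, h⟩, by rw [hz]⟩
  have hs : ss R X [a] = ss R X [a] * pp R X (cylFol X [a] []) := by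
    rw [← sd_ss_of_mem hX ha, ← mul_assoc, ss_sd_ss_letter]
  have hs' : ss R X [a] = pp R X (cylFol X [] [a]) * ss R X [a] := by
    rw [← ss_sd_of_mem hX ha, ss_sd_ss_letter]
  induction hB using BooleanSubalgebra.closure_bot_sup_induction with
  | mem B hB =>
    obtain ⟨α, hα, β, hβ, rfl⟩ := hB
    rcases β with _ | ⟨b, β⟩
    · have hset : pre X [a] (cylFol X α []) = cylFol X (α ++ [a]) [] := by
        ext x
        constructor
        · rintro ⟨y, ⟨z, hz, h⟩, hy⟩
          refine ⟨x, rfl, ?_⟩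
          rw [Stream'.append_append_stream, ← hy, hz]
          exact h
        · rintro ⟨z, hz, h⟩
          rw [Stream'.nil_append_stream] at hz
          rw [Stream'.append_append_stream] at h
          exact ⟨⟨_, hX.of_append_mem h⟩, ⟨_, rfl, h⟩, by rw [hz]⟩
      rw [hset]
      -- The word relations hold only for words of the language. For other words the set is empty,
      -- and both sides have to be shown to vanish.
      by_cases hαa : α ++ [a] ∈ language X
      · refine ⟨cylFol_mem_nil_right hX hαa, ?_⟩
        rw [← sd_ss_of_mem hX hαa, ss_append, sd_append]
        conv_lhs => rw [hs', ← mul_assoc, pp_comm (cylFol_mem X hα hβ) (cylFol_mem_nil_left hX ha),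
          ← ss_sd_of_mem hX ha, ← sd_ss_of_mem hX hα]
        simp only [mul_assoc]
      · have hE : cylFol X (α ++ [a]) [] = ∅ := by
          rw [Set.eq_empty_iff_forall_notMem]
          rintro x ⟨z, -, h⟩
          exact hαa (mem_language_iff.2 ⟨z, h⟩)
        refine ⟨hE ▸ empty_mem_boolAlg X, ?_⟩
        rw [hE, pp_empty, mul_zero, hs', ← mul_assoc,
          ← pp_inter (cylFol_mem X hα hβ) (cylFol_mem_nil_left hX ha)]
        have : cylFol X α [] ∩ cylFol X [] [a] = ∅ := by
          rw [Set.eq_empty_iff_forall_notMem]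
          rintro x ⟨⟨z, hz, h⟩, ⟨w, hw, -⟩⟩
          rw [Stream'.nil_append_stream] at hz
          refine hαa (mem_language_iff.2 ⟨w, ?_⟩)
          rwa [Stream'.append_append_stream, ← hw, hz]
        rw [this, pp_empty, zero_mul]
    · by_cases hab : b = a
      · subst hab
        have hβ' : β ∈ language X := hX.language_of_append_right (α := [b]) hβ
        have hset : pre X [b] (cylFol X α (b :: β)) = cylFol X α β ∩ cylFol X [b] [] := by
          ext x
          rw [Set.mem_inter_iff, ← hmem x]
          constructor
          · rintro ⟨y, ⟨z, hz, h⟩, hy⟩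
            rw [hy] at hz
            exact ⟨⟨z, Stream'.append_right_injective [b] _ _ hz, h⟩, y, hy⟩
          · rintro ⟨⟨z, hz, h⟩, y, hy⟩
            exact ⟨y, ⟨z, by rw [hy, hz]; rfl, h⟩, hy⟩
        rw [hset]
        refine ⟨inter_mem_boolAlg (cylFol_mem X hα hβ') (cylFol_mem_nil_right hX ha), ?_⟩
        rw [pp_inter (cylFol_mem X hα hβ') (cylFol_mem_nil_right hX ha),
          ← word_rel hα hβ', ← word_rel hα hβ, ← sd_ss_of_mem hX ha, ss_cons b β, sd_cons b β]
        simp only [mul_assoc]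
      · have hE : pre X [a] (cylFol X α (b :: β)) = ∅ := by
          rw [Set.eq_empty_iff_forall_notMem]
          rintro x ⟨y, ⟨z, hz, -⟩, hy⟩
          rw [hy] at hz
          exact hab (congrArg Stream'.head hz).symm
        refine ⟨hE ▸ empty_mem_boolAlg X, ?_⟩
        rw [hE, pp_empty, mul_zero, hs', ← mul_assoc,
          ← pp_inter (cylFol_mem X hα hβ) (cylFol_mem_nil_left hX ha)]
        have : cylFol X α (b :: β) ∩ cylFol X [] [a] = ∅ := by
          rw [Set.eq_empty_iff_forall_notMem]
          rintro x ⟨⟨z, hz, -⟩, ⟨w, hw, -⟩⟩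
          rw [hz] at hw
          exact hab (congrArg Stream'.head hw)
        rw [this, pp_empty, zero_mul]
  | bot =>
    have : pre X [a] ⊥ = ∅ := by
      rw [Set.eq_empty_iff_forall_notMem]
      rintro x ⟨y, hy, -⟩
      exact hy
    rw [this, Set.bot_eq_empty, pp_empty, zero_mul, mul_zero]
    exact ⟨empty_mem_boolAlg X, rfl⟩
  | sup B hB C hC ihB ihC =>
    have hset : pre X [a] (B ⊔ C) = pre X [a] B ∪ pre X [a] C := by
      ext x
      simp only [pre, Set.sup_eq_union, Set.mem_union, Set.mem_ofPred_eq, or_and_right, exists_or]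
    rw [hset]
    change _ ∧ pp R X (B ∪ C) * _ = _
    rw [pp_union hB hC, pp_union ihB.1 ihC.1, pp_inter hB hC,
      pp_inter ihB.1 ihC.1]
    refine ⟨union_mem_boolAlg ihB.1 ihC.1, ?_⟩
    rw [sub_mul, add_mul, mul_assoc, ihC.2, ← mul_assoc, ihB.2, mul_sub, mul_add, mul_assoc]
  | compl B hB ihB =>
    -- Preimages under prefixing by `a` respect complements only inside the domain `C(a, ω)`, whose
    -- projection is absorbed by `s_a`.
    have hset : pre X [a] Bᶜ = cylFol X [a] [] ∩ (pre X [a] B)ᶜ := by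
      ext x
      rw [Set.mem_inter_iff, ← hmem x]
      constructor
      · rintro ⟨y, hy, h⟩
        refine ⟨⟨y, h⟩, ?_⟩
        rintro ⟨z, hz, h'⟩
        rw [← h] at h'
        exact hy (Subtype.ext h' ▸ hz)
      · rintro ⟨⟨y, h⟩, hn⟩
        exact ⟨y, fun hy => hn ⟨y, hy, h⟩, h⟩
    rw [hset, pp_inter (cylFol_mem_nil_right hX ha) (BooleanSubalgebra.compl_mem ihB.1),
      pp_compl hB, pp_compl ihB.1, ← mul_assoc, ← hs, sub_mul, mul_sub, one_mul, mul_one, ihB.2]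
    exact ⟨inter_mem_boolAlg (cylFol_mem_nil_right hX ha)
      (BooleanSubalgebra.compl_mem ihB.1), rfl⟩

/-- On the generators this is a word relation. It extends to the Boolean algebra because conjugation
by `s_a` is multiplicative on projections and sends `1` to the projection of `C(ω, a)`. -/
theorem img_letter (a : 𝓐) {B : Set X} (hB : B ∈ boolAlg X) :
    img X [a] B ∈ boolAlg X ∧
      ss R X [a] * pp R X B * sd R X [a] = pp R X (img X [a] B) := by
  have ha := hX.letter_mem a
  have hs : ss R X [a] = ss R X [a] * pp R X (cylFol X [a] []) := by
    rw [← sd_ss_of_mem hX ha, ← mul_assoc, ss_sd_ss_letter]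
  induction hB using BooleanSubalgebra.closure_bot_sup_induction with
  | mem B hB =>
    obtain ⟨α, hα, β, hβ, rfl⟩ := hB
    have hset : img X [a] (cylFol X α β) = cylFol X α ([a] ++ β) := by
      ext x
      constructor
      · rintro ⟨y, ⟨z, hz, h⟩, hy⟩
        exact ⟨z, by rw [hy, hz]; rfl, h⟩
      · rintro ⟨z, hz, h⟩
        have h' := x.2
        rw [hz] at h'
        exact ⟨⟨β ++ₛ z, hX.tail_mem _ h'⟩, ⟨z, rfl, h⟩, hz⟩
    rw [hset]
    by_cases hab : [a] ++ β ∈ language X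
    · refine ⟨cylFol_mem X hα hab, ?_⟩
      rw [← word_rel hα hβ, ← word_rel hα hab, ss_append, sd_append]
      simp only [mul_assoc]
    · have hE : cylFol X α ([a] ++ β) = ∅ := by
        rw [Set.eq_empty_iff_forall_notMem]
        rintro x ⟨z, hz, -⟩
        exact hab (mem_language_iff.2 ⟨z, hz ▸ x.2⟩)
      have hE' : cylFol X [a] [] ∩ cylFol X α β = ∅ := by
        rw [Set.eq_empty_iff_forall_notMem]
        rintro x ⟨⟨z, hz, h⟩, ⟨w, hw, -⟩⟩
        rw [Stream'.nil_append_stream] at hz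
        refine hab (mem_language_iff.2 ⟨w, ?_⟩)
        rwa [Stream'.append_append_stream, ← hw, hz]
      rw [hE, pp_empty, hs, mul_assoc (ss R X [a]),
        ← pp_inter (cylFol_mem_nil_right hX ha) (cylFol_mem X hα hβ), hE', pp_empty, mul_zero,
        zero_mul]
      exact ⟨empty_mem_boolAlg X, rfl⟩
  | bot =>
    have : img X [a] ⊥ = ∅ := by
      rw [Set.eq_empty_iff_forall_notMem]
      rintro x ⟨y, hy, -⟩
      exact hy
    rw [this, Set.bot_eq_empty, pp_empty, mul_zero, zero_mul]
    exact ⟨empty_mem_boolAlg X, rfl⟩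
  | sup B hB C hC ihB ihC =>
    have hset : img X [a] (B ⊔ C) = img X [a] B ∪ img X [a] C := by
      ext x
      simp only [img, Set.sup_eq_union, Set.mem_union, Set.mem_ofPred_eq, or_and_right, exists_or]
    rw [hset]
    change _ ∧ _ * pp R X (B ∪ C) * _ = _
    rw [pp_union hB hC, pp_union ihB.1 ihC.1, pp_inter hB hC,
      pp_inter ihB.1 ihC.1, ← ihB.2, ← ihC.2]
    refine ⟨union_mem_boolAlg ihB.1 ihC.1, ?_⟩
    -- The inner `s_a^* s_a` is a projection that commutes with `p_B` and is absorbed by `s_a` on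
    -- the left.
    have key : ss R X [a] * pp R X B * sd R X [a] * (ss R X [a] * pp R X C * sd R X [a]) =
        ss R X [a] * (pp R X B * pp R X C) * sd R X [a] := by
      calc _ = ss R X [a] * (pp R X B * (sd R X [a] * ss R X [a])) * pp R X C * sd R X [a] := by
            simp only [mul_assoc]
        _ = _ := by
            rw [sd_ss_of_mem hX ha, pp_comm hB (cylFol_mem_nil_right hX ha), ← mul_assoc, ← hs]
            simp only [mul_assoc]
    rw [key, mul_sub, mul_add, sub_mul, add_mul]
  | compl B hB ihB =>
    have hset : img X [a] Bᶜ = cylFol X [] [a] ∩ (img X [a] B)ᶜ := by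
      ext x
      constructor
      · rintro ⟨y, hy, h⟩
        refine ⟨⟨y, h, y.2⟩, ?_⟩
        rintro ⟨z, hz, h'⟩
        rw [h] at h'
        exact hy (Subtype.ext (Stream'.append_right_injective [a] _ _ h') ▸ hz)
      · rintro ⟨⟨y, h, h'⟩, hn⟩
        exact ⟨⟨y, h'⟩, fun hy => hn ⟨_, hy, h⟩, h⟩
    rw [hset, pp_inter (cylFol_mem_nil_left hX ha) (BooleanSubalgebra.compl_mem ihB.1),
      pp_compl hB, pp_compl ihB.1, ← ihB.2, ← ss_sd_of_mem hX ha]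
    refine ⟨inter_mem_boolAlg (cylFol_mem_nil_left hX ha)
      (BooleanSubalgebra.compl_mem ihB.1), ?_⟩
    rw [mul_sub, mul_sub, sub_mul, mul_one, mul_one, ← mul_assoc, ← mul_assoc, ss_sd_ss_letter]

theorem pre_mem (α : List 𝓐) {B : Set X} (hB : B ∈ boolAlg X) : pre X α B ∈ boolAlg X := by
  induction α generalizing B with
  | nil => simpa
  | cons a α ih =>
    rw [pre_cons hX]
    -- Membership in the Boolean algebra does not involve the coefficients; `ℤ` only instantiates
    -- the identity bundled with it.
    exact ih (pre_letter (R := ℤ) hX a hB).1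

theorem img_mem (α : List 𝓐) {B : Set X} (hB : B ∈ boolAlg X) : img X α B ∈ boolAlg X := by
  induction α with
  | nil => simpa
  | cons a α ih =>
    rw [img_cons hX]
    exact (img_letter (R := ℤ) hX a ih).1

theorem pp_mul_ss (α : List 𝓐) {B : Set X} (hB : B ∈ boolAlg X) :
    pp R X B * ss R X α = ss R X α * pp R X (pre X α B) := by
  induction α generalizing B with
  | nil => simp
  | cons a α ih =>
    rw [pre_cons hX, ss_cons, ← mul_assoc, (pre_letter hX a hB).2, mul_assoc,
      ih (pre_letter (R := R) hX a hB).1, mul_assoc]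

theorem sd_mul_pp (α : List 𝓐) {B : Set X} (hB : B ∈ boolAlg X) :
    sd R X α * pp R X B = pp R X (pre X α B) * sd R X α := by
  induction α generalizing B with
  | nil => simp
  | cons a α ih =>
    have ha := hX.letter_mem a
    have hl : sd R X [a] * pp R X B = pp R X (pre X [a] B) * sd R X [a] := by
      have hB' := pre_letter (R := R) hX a hB
      calc sd R X [a] * pp R X B
          = sd R X [a] * (ss R X [a] * sd R X [a] * pp R X B) := by
            rw [← mul_assoc, ← mul_assoc, sd_ss_sd_letter]
        _ = sd R X [a] * (pp R X B * ss R X [a]) * sd R X [a] := by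
            rw [ss_sd_of_mem hX ha, pp_comm (cylFol_mem_nil_left hX ha) hB, ← ss_sd_of_mem hX ha]
            simp only [mul_assoc]
        _ = sd R X [a] * ss R X [a] * pp R X (pre X [a] B) * sd R X [a] := by
            rw [hB'.2]
            simp only [mul_assoc]
        _ = pp R X (pre X [a] B) * sd R X [a] := by
            rw [sd_ss_of_mem hX ha, pp_comm (cylFol_mem_nil_right hX ha) hB'.1, mul_assoc,
              ← sd_ss_of_mem hX ha, sd_ss_sd_letter]
    rw [pre_cons hX, sd_cons, mul_assoc, hl, ← mul_assoc, ih (pre_letter (R := R) hX a hB).1,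
      mul_assoc]

theorem ss_mul_pp_mul_sd (α : List 𝓐) {B : Set X} (hB : B ∈ boolAlg X) :
    ss R X α * pp R X B * sd R X α = pp R X (img X α B) := by
  induction α with
  | nil => simp
  | cons a α ih =>
    rw [img_cons hX, ← (img_letter hX a (img_mem hX α hB)).2, ← ih, ss_cons, sd_cons]
    simp only [mul_assoc]

/-- Induction on letters removes the restriction to the language: for a word outside it, the
preimage is empty and the product is `0`. -/
theorem sd_mul_ss (α : List 𝓐) : sd R X α * ss R X α = pp R X (pre X α Set.univ) := by
  induction α with
  | nil => simp [pp_univ]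
  | cons a α ih =>
    have hu : (Set.univ : Set X) ∈ boolAlg X := (univ_mem_boolAlg X)
    have ha := hX.letter_mem a
    have h1 : pre X [a] Set.univ = cylFol X [a] [] := by
      ext x
      constructor
      · rintro ⟨y, -, hy⟩
        exact ⟨x, rfl, hy ▸ y.2⟩
      · rintro ⟨z, hz, h⟩
        rw [Stream'.nil_append_stream] at hz
        exact ⟨⟨_, h⟩, trivial, by rw [hz]⟩
    have hm := pre_mem hX [a] hu
    have hsub : pre X α Set.univ ∩ pre X α (pre X [a] Set.univ) =
        pre X α (pre X [a] Set.univ) := by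
      rw [Set.inter_eq_right]
      rintro x ⟨y, -, hy⟩
      exact ⟨y, trivial, hy⟩
    rw [ss_cons, sd_cons, mul_assoc, ← mul_assoc (sd R X [a]), sd_ss_of_mem hX ha, ← h1,
      pp_mul_ss hX α hm, ← mul_assoc, ih, ← pp_inter (pre_mem hX α hu) (pre_mem hX α hm), hsub,
      ← pre_cons hX]

theorem sd_mul_pp_mul_ss (α : List 𝓐) {B : Set X} (hB : B ∈ boolAlg X) :
    sd R X α * pp R X B * ss R X α = pp R X (pre X α B) := by
  rw [mul_assoc, pp_mul_ss hX α hB, ← mul_assoc, sd_mul_ss hX,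
    ← pp_inter (pre_mem hX α (univ_mem_boolAlg X)) (pre_mem hX α hB)]
  congr 1
  rw [Set.inter_eq_right]
  rintro x ⟨y, -, hy⟩
  exact ⟨y, trivial, hy⟩

theorem ss_mul_pp_pre_univ (α : List 𝓐) :
    ss R X α * pp R X (pre X α Set.univ) = ss R X α := by
  rw [← pp_mul_ss hX α (univ_mem_boolAlg X), pp_univ, one_mul]

theorem pp_pre_univ_mul_sd (α : List 𝓐) :
    pp R X (pre X α Set.univ) * sd R X α = sd R X α := by
  rw [← sd_mul_pp hX α (univ_mem_boolAlg X), pp_univ, mul_one]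

end Algebra

end

section

/-! ### Two-sided ideals and the socle of a ring -/

section Ring

variable {B : Type*} [Ring B]

/-- The free middle factor `c` absorbs the multipliers met in each of the two span inductions. -/
theorem mul_eq_zero_of_mem_span {e f : B} (h : ∀ c, e * c * f = 0) {a b : B}
    (ha : a ∈ TwoSidedIdeal.span {e}) (hb : b ∈ TwoSidedIdeal.span {f}) : a * b = 0 := by
  have h1 : ∀ c, a * c * f = 0 := by
    induction ha using TwoSidedIdeal.span_induction with
    | mem x hx => rw [Set.mem_singleton_iff.1 hx]; exact h
    | zero => simp
    | add x y _ _ hx hy => intro c; rw [add_mul, add_mul, hx, hy, add_zero]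
    | neg x _ hx => intro c; rw [neg_mul, neg_mul, hx, neg_zero]
    | left_absorb d x _ hx => intro c; rw [mul_assoc, mul_assoc, ← mul_assoc x, hx, mul_zero]
    | right_absorb d x _ hx => intro c; rw [mul_assoc x, hx]
  have h2 : ∀ c, a * c * b = 0 := by
    induction hb using TwoSidedIdeal.span_induction with
    | mem x hx => rw [Set.mem_singleton_iff.1 hx]; exact h1
    | zero => simp
    | add x y _ _ hx hy => intro c; rw [mul_add, hx, hy, add_zero]
    | neg x _ hx => intro c; rw [mul_neg, hx, neg_zero]
    | left_absorb d x _ hx => intro c; rw [← mul_assoc, mul_assoc a, hx]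
    | right_absorb d x _ hx => intro c; rw [← mul_assoc, hx, zero_mul]
  simpa using h2 1

theorem isAtom_span_singleton {e : B} (he : e ≠ 0) (h : ∀ u, u * e ≠ 0 → ∃ v, v * (u * e) = e) :
    IsAtom (Ideal.span {e}) := by
  refine ⟨fun h0 => he (Ideal.span_singleton_eq_bot.1 h0), fun I hI => ?_⟩
  by_contra hne
  obtain ⟨a, haI, ha⟩ := (Submodule.ne_bot_iff I).1 hne
  obtain ⟨u, rfl⟩ := Ideal.mem_span_singleton'.1 (hI.le haI)
  obtain ⟨v, hv⟩ := h u ha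
  refine hI.not_ge ((Ideal.span_singleton_le_iff_mem I).2 ?_)
  rw [← hv]
  exact I.mul_mem_left _ haI

/-- The hypothesis passes from `e` to every right multiple `e b`, so each left ideal `B e b` is
minimal or zero, and these generate the two-sided ideal of `e`. -/
theorem asIdeal_span_le_socle {e : B} (h : ∀ u, u * e ≠ 0 → ∃ v, v * (u * e) = e) :
    (TwoSidedIdeal.span {e}).asIdeal ≤ socle B := by
  intro a ha
  have key : ∀ b, a * b ∈ socle B := by
    rw [TwoSidedIdeal.mem_asIdeal] at ha
    induction ha using TwoSidedIdeal.span_induction with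
    | mem x hx =>
      rw [Set.mem_singleton_iff.1 hx]
      intro b
      by_cases hb : e * b = 0
      · rw [hb]
        exact zero_mem _
      · have hat : IsAtom (Ideal.span {e * b}) := by
          refine isAtom_span_singleton hb fun u hu => ?_
          obtain ⟨v, hv⟩ := h u fun h0 => hu (by rw [← mul_assoc, h0, zero_mul])
          exact ⟨v, by rw [← mul_assoc u, ← mul_assoc v, hv]⟩
        exact le_sSup (show Ideal.span {e * b} ∈ {I : Ideal B | IsAtom I} from hat)
          (Ideal.mem_span_singleton_self _)
    | zero => simp
    | add x y _ _ hx hy => intro c; rw [add_mul]; exact add_mem (hx c) (hy c)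
    | neg x _ hx => intro c; rw [neg_mul]; exact neg_mem (hx c)
    | left_absorb d x _ hx => intro c; rw [mul_assoc]; exact Ideal.mul_mem_left _ _ (hx c)
    | right_absorb d x _ hx => intro c; rw [mul_assoc]; exact hx _
  simpa using key 1

/-- Mutually annihilating two-sided ideals with local left units are independent. -/
theorem iSupIndep_asIdeal {ι : Type*} (I : ι → TwoSidedIdeal B)
    (hmul : ∀ i j, i ≠ j → ∀ a ∈ I i, ∀ b ∈ I j, a * b = 0)
    (hunit : ∀ i, ∀ a ∈ I i, ∃ e ∈ I i, e * a = a) :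
    iSupIndep fun i => (I i).asIdeal := by
  intro i
  rw [Submodule.disjoint_def]
  intro a ha ha'
  have : ∀ e ∈ I i, e * a = 0 := by
    clear ha
    rw [iSup_subtype'] at ha'
    induction ha' using Submodule.iSup_induction' with
    | mem j x hx => exact fun e he => hmul i j.1 (Ne.symm j.2) e he x hx
    | zero => simp
    | add x y _ _ hx hy => intro e he; rw [mul_add, hx _ he, hy _ he, add_zero]
  obtain ⟨e, he, hea⟩ := hunit i a ha
  rw [← hea, this e he]

end Ring

variable {𝓐 : Type u} {R : Type v} [CommRing R] {X : Set (Stream' 𝓐)}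

/-! ### Monomials -/

/-- The monomial `s_α p_A s_β^*`. -/
def mon (R : Type v) [CommRing R] (X : Set (Stream' 𝓐)) (α : List 𝓐) (A : Set X)
    (β : List 𝓐) : Alg R X :=
  ss R X α * pp R X A * sd R X β

theorem one_eq_mon : (1 : Alg R X) = mon R X [] Set.univ [] := by
  simp [mon, pp_univ]

section

variable (hX : IsFull X)
include hX

theorem pp_mul_mon {A B : Set X} (hA : A ∈ boolAlg X) (hB : B ∈ boolAlg X) (α β : List 𝓐) :
    pp R X B * mon R X α A β = mon R X α (pre X α B ∩ A) β := by
  rw [mon, mon, pp_inter (pre_mem hX α hB) hA, ← mul_assoc, ← mul_assoc, pp_mul_ss hX α hB]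
  simp only [mul_assoc]

omit hX in
theorem ss_mul_mon (a : 𝓐) (A : Set X) (α β : List 𝓐) :
    ss R X [a] * mon R X α A β = mon R X (a :: α) A β := by
  rw [mon, mon, ss_cons a α]
  simp only [mul_assoc]

theorem sd_mul_mon_nil (a : 𝓐) {A : Set X} (hA : A ∈ boolAlg X) (β : List 𝓐) :
    sd R X [a] * mon R X [] A β = mon R X [] (pre X [a] A) (β ++ [a]) := by
  rw [mon, mon, ss_nil, one_mul, one_mul, ← mul_assoc, sd_mul_pp hX [a] hA, sd_append, mul_assoc]

theorem sd_mul_ss_letter_ne {a b : 𝓐} (h : a ≠ b) : sd R X [a] * ss R X [b] = 0 := by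
  have hi := img_mem hX [a] (univ_mem_boolAlg X)
  have hE : pre X [b] (img X [a] Set.univ) = ∅ := by
    rw [Set.eq_empty_iff_forall_notMem]
    rintro x ⟨y, ⟨z, -, hz⟩, hy⟩
    rw [hz] at hy
    exact h (congrArg Stream'.head hy)
  rw [← sd_ss_sd_letter, mul_assoc (sd R X [a]), ← mul_one (ss R X [a]), ← pp_univ,
    ss_mul_pp_mul_sd hX [a] (univ_mem_boolAlg X), mul_assoc, pp_mul_ss hX [b] hi, hE, pp_empty,
    mul_zero, mul_zero]

theorem sd_mul_mon_cons_self (a : 𝓐) {A : Set X} (hA : A ∈ boolAlg X) (α β : List 𝓐) :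
    sd R X [a] * mon R X (a :: α) A β = mon R X α (pre X α (pre X [a] Set.univ) ∩ A) β := by
  rw [← ss_mul_mon, ← mul_assoc, sd_mul_ss hX,
    pp_mul_mon hX hA (pre_mem hX _ (univ_mem_boolAlg X))]

theorem sd_mul_mon_cons_ne {a b : 𝓐} (h : a ≠ b) (A : Set X) (α β : List 𝓐) :
    sd R X [a] * mon R X (b :: α) A β = 0 := by
  rw [← ss_mul_mon, ← mul_assoc, sd_mul_ss_letter_ne hX h, zero_mul]

/-- The span of the monomials contains `1` and is stable under left multiplication by each
generator, hence it is everything. -/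
theorem mem_span_mon (a : Alg R X) :
    a ∈ Submodule.span R {m | ∃ α, ∃ A ∈ boolAlg X, ∃ β, m = mon R X α A β} := by
  set S := Submodule.span R {m | ∃ α, ∃ A ∈ boolAlg X, ∃ β, m = mon R X α A β} with hS
  have hm : ∀ α β, ∀ A ∈ boolAlg X, mon R X α A β ∈ S := fun α β A hA =>
    Submodule.subset_span ⟨α, A, hA, β, rfl⟩
  have key : ∀ f : Free R X, ∀ m ∈ S, RingQuot.mkAlgHom R (Rel R X) f * m ∈ S := by
    intro f
    induction f using FreeAlgebra.induction with
    | grade0 r =>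
      intro m hm
      rw [AlgHom.commutes, ← Algebra.smul_def]
      exact S.smul_mem r hm
    | grade1 g =>
      intro m hm'
      induction hm' using Submodule.span_induction with
      | mem m hm' =>
        obtain ⟨α, A, hA, β, rfl⟩ := hm'
        rcases g with B | a | a
        · have : RingQuot.mkAlgHom R (Rel R X) (FreeAlgebra.ι R (Gen.p B)) = pp R X B := by
            rw [pp_of_mem B.2]; rfl
          rw [this, pp_mul_mon hX hA B.2]
          exact hm _ _ _ (inter_mem_boolAlg (pre_mem hX _ B.2) hA)
        · have : RingQuot.mkAlgHom R (Rel R X) (FreeAlgebra.ι R (Gen.s a)) = ss R X [a] := by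
            simp [ss, fsWord, fs]
          rw [this, ss_mul_mon]
          exact hm _ _ _ hA
        · have : RingQuot.mkAlgHom R (Rel R X) (FreeAlgebra.ι R (Gen.sStar a)) = sd R X [a] := by
            simp [sd, fsStarWord, fsStar]
          rw [this]
          rcases α with _ | ⟨b, α⟩
          · rw [sd_mul_mon_nil hX a hA]
            exact hm _ _ _ (pre_mem hX _ hA)
          · by_cases hab : a = b
            · subst hab
              rw [sd_mul_mon_cons_self hX a hA]
              exact hm _ _ _
                (inter_mem_boolAlg (pre_mem hX _ (pre_mem hX _ (univ_mem_boolAlg X))) hA)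
            · rw [sd_mul_mon_cons_ne hX hab]
              exact zero_mem _
      | zero => simp
      | add x y _ _ hx hy => rw [mul_add]; exact add_mem hx hy
      | smul r x _ hx => rw [mul_smul_comm]; exact S.smul_mem r hx
    | mul f g hf hg => intro m hm'; rw [map_mul, mul_assoc]; exact hf _ (hg _ hm')
    | add f g hf hg => intro m hm'; rw [map_add, add_mul]; exact add_mem (hf _ hm') (hg _ hm')
  obtain ⟨f, rfl⟩ := RingQuot.mkAlgHom_surjective R (Rel R X) a
  rw [← mul_one (RingQuot.mkAlgHom R (Rel R X) f)]
  refine key f 1 ?_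
  rw [one_eq_mon]
  exact hm _ _ _ (univ_mem_boolAlg X)

/-! ### Isolated points -/

theorem isolated_of_append {α : List 𝓐} {x y : X} (h : (y : Stream' 𝓐) = α ++ₛ (x : Stream' 𝓐))
    (hy : {y} ∈ boolAlg X) : {x} ∈ boolAlg X :=
  pre_eq_singleton h ▸ pre_mem hX α hy

theorem isolated_append {α : List 𝓐} {x y : X} (h : (y : Stream' 𝓐) = α ++ₛ (x : Stream' 𝓐))
    (hx : {x} ∈ boolAlg X) : {y} ∈ boolAlg X :=
  img_eq_singleton h ▸ img_mem hX α hx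

theorem ss_pt_sd {α : List 𝓐} {x y : X} (h : (y : Stream' 𝓐) = α ++ₛ (x : Stream' 𝓐))
    (hx : {x} ∈ boolAlg X) : ss R X α * pp R X {x} * sd R X α = pp R X {y} := by
  rw [ss_mul_pp_mul_sd hX α hx, img_eq_singleton h]

theorem sd_pt_ss {α : List 𝓐} {x y : X} (h : (y : Stream' 𝓐) = α ++ₛ (x : Stream' 𝓐))
    (hy : {y} ∈ boolAlg X) : sd R X α * pp R X {y} * ss R X α = pp R X {x} := by
  rw [sd_mul_pp_mul_ss hX α hy, pre_eq_singleton h]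

theorem sd_mul_pt {α : List 𝓐} {x y : X} (h : (y : Stream' 𝓐) = α ++ₛ (x : Stream' 𝓐))
    (hy : {y} ∈ boolAlg X) : sd R X α * pp R X {y} = pp R X {x} * sd R X α := by
  rw [sd_mul_pp hX α hy, pre_eq_singleton h]

theorem pt_mul_ss {α : List 𝓐} {x y : X} (h : (y : Stream' 𝓐) = α ++ₛ (x : Stream' 𝓐))
    (hy : {y} ∈ boolAlg X) : pp R X {y} * ss R X α = ss R X α * pp R X {x} := by
  rw [pp_mul_ss hX α hy, pre_eq_singleton h]

/-- Moving `p_{y}` past `s_β^*` cuts `A` down to the points `x` with `βx = y`, of which there is at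
most one. If `αx ∉ X`, then `s_α` kills `p_{x}`. -/
theorem mon_mul_pt {y : X} (hy : {y} ∈ boolAlg X) (α β : List 𝓐) {A : Set X}
    (hA : A ∈ boolAlg X) :
    mon R X α A β * pp R X {y} = 0 ∨
      ∃ x z : X, {x} ∈ boolAlg X ∧ x ∈ A ∧ (y : Stream' 𝓐) = β ++ₛ (x : Stream' 𝓐) ∧
        (z : Stream' 𝓐) = α ++ₛ (x : Stream' 𝓐) ∧
        mon R X α A β * pp R X {y} = ss R X α * pp R X {x} * sd R X β := by
  have hm : mon R X α A β * pp R X {y} = mon R X α (A ∩ pre X β {y}) β := by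
    rw [mon, mon, pp_inter hA (pre_mem hX β hy), mul_assoc, sd_mul_pp hX β hy]
    simp only [mul_assoc]
  rw [hm]
  by_cases h : ∃ x ∈ A, (y : Stream' 𝓐) = β ++ₛ (x : Stream' 𝓐)
  · obtain ⟨x, hxA, hx⟩ := h
    have hxU := isolated_of_append hX hx hy
    rw [pre_eq_singleton hx, Set.inter_eq_right.2 (Set.singleton_subset_iff.2 hxA)]
    by_cases hz : α ++ₛ (x : Stream' 𝓐) ∈ X
    · exact Or.inr ⟨x, ⟨_, hz⟩, hxU, hxA, hx, rfl, rfl⟩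
    · left
      have : pre X α Set.univ ∩ {x} = ∅ := by
        rw [Set.eq_empty_iff_forall_notMem]
        rintro w ⟨⟨v, -, hv⟩, rfl⟩
        exact hz (hv ▸ v.2)
      rw [mon, ← ss_mul_pp_pre_univ hX, mul_assoc (ss R X α),
        ← pp_inter (pre_mem hX α (univ_mem_boolAlg X)) hxU, this, pp_empty, mul_zero, zero_mul]
  · left
    have : A ∩ pre X β {y} = ∅ := by
      rw [Set.eq_empty_iff_forall_notMem]
      rintro x ⟨hxA, hx⟩
      exact h ⟨x, hxA, mem_pre_singleton.1 hx⟩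
    rw [mon, this, pp_empty, mul_zero, zero_mul]

omit hX in
theorem pt_mul_pt_ne {x y : X} (hx : {x} ∈ boolAlg X) (hy : {y} ∈ boolAlg X) (h : x ≠ y) :
    pp R X {x} * pp R X {y} = 0 := by
  rw [← pp_inter hx hy, Set.singleton_inter_eq_empty.2 (by simpa using h), pp_empty]

theorem pt_mul_ss_pt_sd {α β : List 𝓐} {x z : X}
    (hx : {x} ∈ boolAlg X) (hz : (z : Stream' 𝓐) = α ++ₛ (x : Stream' 𝓐)) :
    pp R X {z} * (ss R X α * pp R X {x} * sd R X β) = ss R X α * pp R X {x} * sd R X β := by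
  rw [← mul_assoc, ← mul_assoc, pt_mul_ss hX hz (isolated_append hX hz hx), mul_assoc (ss R X α),
    pp_idem hx]

omit hX in
theorem tailEquiv_of_append {α β : List 𝓐} {x y z : Stream' 𝓐} (hy : y = α ++ₛ x)
    (hz : z = β ++ₛ x) : TailEquiv y z :=
  ⟨α.length, β.length, by rw [hy, hz, Stream'.drop_append_stream, Stream'.drop_append_stream]⟩

theorem exists_append_of_tailEquiv {x y : X} (h : TailEquiv (x : Stream' 𝓐) (y : Stream' 𝓐)) :
    ∃ (α β : List 𝓐) (z : X), (x : Stream' 𝓐) = α ++ₛ (z : Stream' 𝓐) ∧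
      (y : Stream' 𝓐) = β ++ₛ (z : Stream' 𝓐) := by
  obtain ⟨m, n, h⟩ := h
  refine ⟨(x : Stream' 𝓐).take m, (y : Stream' 𝓐).take n, ⟨_, hX.drop_mem x.2 m⟩, ?_, ?_⟩
  · exact (Stream'.append_take_drop _ _).symm
  · change _ = _ ++ₛ (x : Stream' 𝓐).drop m
    rw [h, Stream'.append_take_drop]

/-- Tail-equivalent isolated points are linked by a partial isometry. -/
theorem exists_link_of_tailEquiv {x y : X} (hx : {x} ∈ boolAlg X)
    (h : TailEquiv (x : Stream' 𝓐) (y : Stream' 𝓐)) :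
    ∃ v w : Alg R X, v * pp R X {y} * w = pp R X {x} ∧ w * pp R X {x} * v = pp R X {y} := by
  obtain ⟨α, β, z, hxz, hyz⟩ := exists_append_of_tailEquiv hX h
  have hz := isolated_of_append hX hxz hx
  have hy := isolated_append hX hyz hz
  refine ⟨ss R X α * sd R X β, ss R X β * sd R X α, ?_, ?_⟩
  · calc _ = ss R X α * (sd R X β * pp R X {y} * ss R X β) * sd R X α := by
          simp only [mul_assoc]
      _ = _ := by rw [sd_pt_ss hX hyz hy, ss_pt_sd hX hxz hz]
  · calc _ = ss R X β * (sd R X α * pp R X {x} * ss R X α) * sd R X β := by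
          simp only [mul_assoc]
      _ = _ := by rw [sd_pt_ss hX hxz hx, ss_pt_sd hX hyz hz]

theorem pt_mem_span_of_tailEquiv {x y : X} (hx : {x} ∈ boolAlg X)
    (h : TailEquiv (x : Stream' 𝓐) (y : Stream' 𝓐)) :
    pp R X {x} ∈ TwoSidedIdeal.span {pp R X {y}} := by
  obtain ⟨v, w, hvw, -⟩ := exists_link_of_tailEquiv (R := R) hX hx h
  rw [← hvw]
  exact TwoSidedIdeal.mul_mem_right _ _ _ (TwoSidedIdeal.mul_mem_left _ _ _
    (TwoSidedIdeal.subset_span rfl))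

theorem span_pt_eq_of_tailEquiv {x y : X} (hx : {x} ∈ boolAlg X) (hy : {y} ∈ boolAlg X)
    (h : TailEquiv (x : Stream' 𝓐) (y : Stream' 𝓐)) :
    TwoSidedIdeal.span {pp R X {x}} = TwoSidedIdeal.span {pp R X {y}} := by
  apply le_antisymm <;> rw [TwoSidedIdeal.span_le, Set.singleton_subset_iff]
  · exact pt_mem_span_of_tailEquiv hX hx h
  · exact pt_mem_span_of_tailEquiv hX hy (tailEquiv_equivalence.symm h)

theorem pt_mul_mul_pt_eq_zero {x y : X} (hx : {x} ∈ boolAlg X) (hy : {y} ∈ boolAlg X)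
    (h : ¬ TailEquiv (x : Stream' 𝓐) (y : Stream' 𝓐)) (c : Alg R X) :
    pp R X {x} * c * pp R X {y} = 0 := by
  induction mem_span_mon hX c using Submodule.span_induction with
  | mem m hm =>
    obtain ⟨α, A, hA, β, rfl⟩ := hm
    rw [mul_assoc]
    obtain h0 | ⟨w, z, hw, -, hyw, hzw, he⟩ := mon_mul_pt (R := R) hX hy α β hA
    · rw [h0, mul_zero]
    · rw [he, ← pt_mul_ss_pt_sd hX hw hzw, ← mul_assoc, pt_mul_pt_ne hx (isolated_append hX hzw hw),
        zero_mul]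
      rintro rfl
      exact h (tailEquiv_of_append hzw hyw)
  | zero => simp
  | add a b _ _ ha hb => rw [mul_add, add_mul, ha, hb, add_zero]
  | smul r a _ ha => rw [mul_smul_comm, smul_mul_assoc, ha, smul_zero]

omit hX in
theorem sum_pt_mul_sum_pt {S T : Finset X} (hT : ∀ x ∈ T, {x} ∈ boolAlg X) (h : S ⊆ T) :
    (∑ x ∈ T, pp R X {x}) * (∑ x ∈ S, pp R X {x}) = ∑ x ∈ S, pp R X {x} := by
  rw [Finset.mul_sum]
  refine Finset.sum_congr rfl fun x hx => ?_
  rw [Finset.sum_mul, Finset.sum_eq_single_of_mem x (h hx), pp_idem (hT x (h hx))]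
  intro y hy hne
  exact pt_mul_pt_ne (hT y hy) (hT x (h hx)) hne

/-- Local left units for the ideal of an isolated point. -/
theorem exists_local_unit {q : X} (hq : {q} ∈ boolAlg X) {a : Alg R X}
    (ha : a ∈ TwoSidedIdeal.span {pp R X {q}}) :
    ∃ S : Finset X, (∀ x ∈ S, {x} ∈ boolAlg X ∧ TailEquiv (x : Stream' 𝓐) (q : Stream' 𝓐)) ∧
      (∑ x ∈ S, pp R X {x}) * a = a := by
  classical
  set P : Alg R X → Prop := fun a => ∃ S : Finset X,
    (∀ x ∈ S, {x} ∈ boolAlg X ∧ TailEquiv (x : Stream' 𝓐) (q : Stream' 𝓐)) ∧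
      (∑ x ∈ S, pp R X {x}) * a = a with hP
  have hadd : ∀ a b, P a → P b → P (a + b) := by
    rintro a b ⟨S, hS, ha⟩ ⟨T, hT, hb⟩
    have hU : ∀ x ∈ S ∪ T, {x} ∈ boolAlg X ∧ TailEquiv (x : Stream' 𝓐) (q : Stream' 𝓐) := by
      intro x hx
      obtain h | h := Finset.mem_union.1 hx
      exacts [hS x h, hT x h]
    refine ⟨S ∪ T, hU, ?_⟩
    rw [mul_add]
    congr 1
    · rw [← ha, ← mul_assoc,
        sum_pt_mul_sum_pt (fun x hx => (hU x hx).1) Finset.subset_union_left]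
    · rw [← hb, ← mul_assoc,
        sum_pt_mul_sum_pt (fun x hx => (hU x hx).1) Finset.subset_union_right]
  have hzero : P 0 := ⟨∅, by simp, by simp⟩
  have hright : ∀ a b, P a → P (a * b) := by
    rintro a b ⟨S, hS, ha⟩
    exact ⟨S, hS, by rw [← mul_assoc, ha]⟩
  have hsmul : ∀ (r : R) a, P a → P (r • a) := by
    rintro r a ⟨S, hS, ha⟩
    exact ⟨S, hS, by rw [mul_smul_comm, ha]⟩
  have hleft : ∀ {x : X}, {x} ∈ boolAlg X → TailEquiv (x : Stream' 𝓐) (q : Stream' 𝓐) →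
      ∀ c : Alg R X, P (c * pp R X {x}) := by
    intro x hx hxq c
    induction mem_span_mon hX c using Submodule.span_induction with
    | mem m hm =>
      obtain ⟨α, A, hA, β, rfl⟩ := hm
      obtain h0 | ⟨w, z, hw, -, hyw, hzw, he⟩ := mon_mul_pt (R := R) hX hx α β hA
      · rw [h0]
        exact hzero
      · refine ⟨{z}, ?_, by rw [he, Finset.sum_singleton, pt_mul_ss_pt_sd hX hw hzw]⟩
        intro y hy
        rw [Finset.mem_singleton.1 hy]
        exact ⟨isolated_append hX hzw hw,
          tailEquiv_equivalence.trans (tailEquiv_of_append hzw hyw) hxq⟩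
    | zero => rw [zero_mul]; exact hzero
    | add a b _ _ ha hb => rw [add_mul]; exact hadd _ _ ha hb
    | smul r a _ ha => rw [smul_mul_assoc]; exact hsmul _ _ ha
  have hsum : ∀ (S : Finset X) (f : X → Alg R X), (∀ x ∈ S, P (f x)) → P (∑ x ∈ S, f x) :=
    fun S f h => Finset.sum_induction f P hadd hzero h
  induction ha using TwoSidedIdeal.span_induction with
  | mem x hx =>
    rw [Set.mem_singleton_iff.1 hx, ← one_mul (pp R X {q})]
    exact hleft hq (tailEquiv_equivalence.refl _) 1
  | zero => exact hzero
  | add x y _ _ hx hy => exact hadd _ _ hx hy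
  | neg x _ hx => rw [← neg_one_smul R x]; exact hsmul _ _ hx
  | left_absorb c x _ hx =>
    obtain ⟨S, hS, hx⟩ := hx
    -- The local unit of `x` turns `c x` into a sum of terms `(c p_{y}) x`, so only units for `c
    -- p_{y}` are needed.
    rw [← hx, ← mul_assoc, Finset.mul_sum, Finset.sum_mul]
    exact hsum _ _ fun y hy => hright _ _ (hleft (hS y hy).1 (hS y hy).2 c)
  | right_absorb c x _ hx => exact hright _ _ hx

end

end

section

variable {𝓐 : Type u}

/-! ### Periodic sequences -/

theorem exists_append_of_append_eq {α β : List 𝓐} {x y : Stream' 𝓐} (h : α ++ₛ x = β ++ₛ y)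
    (hl : α.length ≤ β.length) : ∃ γ, β = α ++ γ ∧ x = γ ++ₛ y := by
  have h1 : α ++ₛ x = β.take α.length ++ₛ (β.drop α.length ++ₛ y) := by
    rw [← Stream'.append_append_stream, List.take_append_drop, h]
  have h2 : α = β.take α.length :=
    Stream'.append_left_injective _ _ _ _ h1 (by rw [List.length_take, min_eq_left hl])
  refine ⟨β.drop α.length, ?_, ?_⟩
  · conv_lhs => rw [← List.take_append_drop α.length β, ← h2]
  · rw [← h2] at h1
    exact Stream'.append_right_injective _ _ _ h1

theorem eq_of_append_eq_self {w : List 𝓐} (hw : w ≠ []) {x y : Stream' 𝓐} (hx : w ++ₛ x = x)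
    (hy : w ++ₛ y = y) : x = y := by
  ext n
  induction n using Nat.strong_induction_on with
  | _ n ih =>
    rcases lt_or_ge n w.length with h | h
    · rw [← hx, ← hy, Stream'.get_append_left _ _ _ h, Stream'.get_append_left _ _ _ h]
    · obtain ⟨m, rfl⟩ := Nat.exists_eq_add_of_le h
      rw [← hx, ← hy, Stream'.get_append_right, Stream'.get_append_right]
      exact ih m (by have := List.length_pos_iff.2 hw; omega)

theorem eq_cycle_of_append_eq_self {w : List 𝓐} (hw : w ≠ []) {x : Stream' 𝓐}
    (hx : w ++ₛ x = x) : x = Stream'.cycle w hw :=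
  eq_of_append_eq_self hw hx (Stream'.cycle_eq w hw).symm

theorem eq_of_append_eq_append {α β : List 𝓐} {x y : Stream' 𝓐} (hx : α ++ₛ x = β ++ₛ x)
    (hy : α ++ₛ y = β ++ₛ y) (hl : α.length ≠ β.length) : x = y := by
  wlog h : α.length ≤ β.length generalizing α β
  · exact this hx.symm hy.symm hl.symm (le_of_not_ge h)
  obtain ⟨γ, rfl, hγ⟩ := exists_append_of_append_eq hx h
  rw [Stream'.append_append_stream] at hy
  refine eq_of_append_eq_self ?_ hγ.symm (Stream'.append_right_injective _ _ _ hy).symm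
  rintro rfl
  simp at hl

/-- A pair of words without a common nonempty suffix. -/
def IsReduced (α β : List 𝓐) : Prop :=
  ∀ α' β' γ, α = α' ++ γ → β = β' ++ γ → γ = []

/-- If say `β = β'γ`, then `x = γy`, and equality of the length differences forces `α = α'γ` as
well. Thus `γ` is a common suffix of a reduced pair and is empty. -/
theorem eq_of_isReduced {α β α' β' : List 𝓐} (h : IsReduced α β) (h' : IsReduced α' β')
    {x y : Stream' 𝓐} (hβ : β' ++ₛ x = β ++ₛ y) (hα : α' ++ₛ x = α ++ₛ y)
    (hl : α.length + β'.length = α'.length + β.length) : α = α' ∧ β = β' := by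
  rcases le_total β'.length β.length with hle | hle
  · obtain ⟨γ, rfl, hγ⟩ := exists_append_of_append_eq hβ hle
    rw [hγ, ← Stream'.append_append_stream] at hα
    have : α' ++ γ = α := Stream'.append_left_injective _ _ _ _ hα (by simp at hl ⊢; omega)
    have hn := h _ _ γ this.symm rfl
    subst hn
    simp [← this]
  · obtain ⟨γ, rfl, hγ⟩ := exists_append_of_append_eq hβ.symm hle
    rw [hγ, ← Stream'.append_append_stream] at hα
    have : α' = α ++ γ := Stream'.append_left_injective _ _ _ _ hα (by simp at hl ⊢; omega)
    have hn := h' _ _ γ this rfl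
    subst hn
    simp [this]

/-- Cancelling the shorter of `β`, `β'` leaves one sequence prefixed by two words of different
lengths with the same result. Such a sequence is purely periodic with a period word fixed by the two
words. -/
theorem eq_of_length_ne {α β α' β' : List 𝓐} {x y x' y' : Stream' 𝓐}
    (hβ : β' ++ₛ x = β ++ₛ y) (hα : α' ++ₛ x = α ++ₛ y)
    (hβ' : β' ++ₛ x' = β ++ₛ y') (hα' : α' ++ₛ x' = α ++ₛ y')
    (hl : α.length + β'.length ≠ α'.length + β.length) : x = x' := by
  rcases le_total β'.length β.length with hle | hle
  · obtain ⟨γ, rfl, rfl⟩ := exists_append_of_append_eq hβ hle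
    rw [Stream'.append_append_stream, Stream'.append_right_inj] at hβ'
    subst hβ'
    rw [← Stream'.append_append_stream] at hα hα'
    rw [eq_of_append_eq_append hα hα' (by simp at hl ⊢; omega)]
  · obtain ⟨γ, rfl, rfl⟩ := exists_append_of_append_eq hβ.symm hle
    rw [Stream'.append_append_stream, Stream'.append_right_inj] at hβ'
    subst hβ'
    rw [← Stream'.append_append_stream] at hα hα'
    exact eq_of_append_eq_append hα hα' (by simp at hl ⊢; omega)

/-- A point that is not of the form `α β^∞`. -/
def IsAperiodic (x : Stream' 𝓐) : Prop :=
  ∀ (α β : List 𝓐) (hβ : β ≠ []), x ≠ α ++ₛ Stream'.cycle β hβ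

theorem IsAperiodic.eq_of_append {q x : Stream' 𝓐} (hq : IsAperiodic q) {α β : List 𝓐}
    (hα : q = α ++ₛ x) (hβ : q = β ++ₛ x) : α = β := by
  wlog h : α.length ≤ β.length generalizing α β
  · exact (this hβ hα (le_of_not_ge h)).symm
  obtain ⟨γ, rfl, hγ⟩ := exists_append_of_append_eq (hα.symm.trans hβ) h
  by_cases hn : γ = []
  · simp [hn]
  · exact absurd (by rw [← eq_cycle_of_append_eq_self hn hγ.symm]; exact hα) (hq α γ hn)

/-- If `q = αβ^∞` lies in `X`, then `α` and `β` are automatically in the language, so restricting to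
language words loses nothing. -/
theorem isAperiodic_of_language {X : Set (Stream' 𝓐)} (hX : IsFull X) {q : X}
    (h : ∀ α ∈ language X, ∀ β ∈ language X, ∀ hβ : β ≠ [],
      (q : Stream' 𝓐) ≠ α ++ₛ Stream'.cycle β hβ) : IsAperiodic (q : Stream' 𝓐) := by
  intro α β hβ he
  have hq : α ++ₛ Stream'.cycle β hβ ∈ X := he ▸ q.2
  refine h α (mem_language_iff.2 ⟨_, hq⟩) β (mem_language_iff.2 ⟨Stream'.cycle β hβ, ?_⟩) hβ he
  rw [← Stream'.cycle_eq]
  exact hX.of_append_mem hq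

/-! ### Corners at aperiodic isolated points -/

/-- A monomial surviving in the corner gives `q = αw = βw`. Aperiodicity forces `α = β`, and the
monomial compresses to `p_{q}`. -/
theorem exists_smul_of_isAperiodic {R : Type v} [CommRing R] {X : Set (Stream' 𝓐)}
    (hX : IsFull X) {q : X} (hq : {q} ∈ boolAlg X) (ha : IsAperiodic (q : Stream' 𝓐))
    (c : Alg R X) : ∃ r : R, pp R X {q} * c * pp R X {q} = r • pp R X {q} := by
  induction mem_span_mon hX c using Submodule.span_induction with
  | mem m hm =>
    obtain ⟨α, A, hA, β, rfl⟩ := hm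
    rw [mul_assoc]
    obtain h0 | ⟨w, z, hw, -, hyw, hzw, he⟩ := mon_mul_pt (R := R) hX hq α β hA
    · exact ⟨0, by rw [h0, mul_zero, zero_smul]⟩
    · rw [he]
      by_cases hqz : q = z
      · subst hqz
        refine ⟨1, ?_⟩
        rw [pt_mul_ss_pt_sd hX hw hzw, ha.eq_of_append hyw hzw, ss_pt_sd hX hzw hw, one_smul]
      · refine ⟨0, ?_⟩
        rw [← pt_mul_ss_pt_sd hX hw hzw, ← mul_assoc,
          pt_mul_pt_ne hq (isolated_append hX hzw hw) hqz, zero_mul, zero_smul]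
  | zero => exact ⟨0, by simp⟩
  | add a b _ _ ha hb =>
    obtain ⟨r, hr⟩ := ha
    obtain ⟨s, hs⟩ := hb
    exact ⟨r + s, by rw [mul_add, add_mul, hr, hs, add_smul]⟩
  | smul r a _ ha =>
    obtain ⟨s, hs⟩ := ha
    exact ⟨r * s, by rw [mul_smul_comm, smul_mul_assoc, hs, smul_smul]⟩

/-- A local unit provides `x ~ q` with `p_{x} u p_{q} ≠ 0`. The link from `x` to `q` carries this
element into the corner at `q`, where it is a nonzero scalar and can be inverted. -/
theorem exists_left_inverse_of_isAperiodic {R : Type v} [Field R] {X : Set (Stream' 𝓐)}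
    (hX : IsFull X) {q : X} (hq : {q} ∈ boolAlg X) (ha : IsAperiodic (q : Stream' 𝓐))
    (u : Alg R X) (hu : u * pp R X {q} ≠ 0) : ∃ v, v * (u * pp R X {q}) = pp R X {q} := by
  obtain ⟨S, hS, hSu⟩ := exists_local_unit (R := R) hX hq (a := u * pp R X {q})
    (TwoSidedIdeal.mul_mem_left _ _ _ (TwoSidedIdeal.subset_span rfl))
  obtain ⟨x, hxS, hx⟩ : ∃ x ∈ S, pp R X {x} * (u * pp R X {q}) ≠ 0 := by
    by_contra! h
    rw [Finset.sum_mul, Finset.sum_eq_zero h] at hSu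
    exact hu hSu.symm
  obtain ⟨hxU, hxq⟩ := hS x hxS
  obtain ⟨v, w, hvw, -⟩ := exists_link_of_tailEquiv (R := R) hX hxU hxq
  obtain ⟨r, hr⟩ := exists_smul_of_isAperiodic (R := R) hX hq ha (w * pp R X {x} * u)
  have hr0 : r ≠ 0 := by
    rintro rfl
    apply hx
    calc pp R X {x} * (u * pp R X {q})
        = v * pp R X {q} * w * pp R X {x} * (u * pp R X {q}) := by rw [hvw, pp_idem hxU]
      _ = v * (pp R X {q} * (w * pp R X {x} * u) * pp R X {q}) := by simp only [mul_assoc]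
      _ = 0 := by rw [hr, zero_smul, mul_zero]
  refine ⟨r⁻¹ • (pp R X {q} * (w * pp R X {x})), ?_⟩
  calc _ = r⁻¹ • (pp R X {q} * (w * pp R X {x} * u) * pp R X {q}) := by
        rw [smul_mul_assoc]
        simp only [mul_assoc]
    _ = _ := by rw [hr, smul_smul, inv_mul_cancel₀ hr0, one_smul]

end

section

open scoped LaurentPolynomial

open LaurentPolynomial (T)

variable {𝓐 : Type u} (R : Type v) [CommRing R] (X : Set (Stream' 𝓐))

/-! ### The graded representation on functions -/

section Rep

variable {R X}

open Classical in
/-- Extension of a function on `X` by zero. -/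
def extend (g : X → R[T;T⁻¹]) (w : Stream' 𝓐) : R[T;T⁻¹] := if h : w ∈ X then g ⟨w, h⟩ else 0

theorem extend_coe (g : X → R[T;T⁻¹]) (w : X) : extend g (w : Stream' 𝓐) = g w := by
  simp [extend]

theorem extend_of_mem (g : X → R[T;T⁻¹]) {w : Stream' 𝓐} (h : w ∈ X) :
    extend g w = g ⟨w, h⟩ := dif_pos h

theorem extend_of_notMem (g : X → R[T;T⁻¹]) {w : Stream' 𝓐} (h : w ∉ X) : extend g w = 0 :=
  dif_neg h

theorem extend_add (g h : X → R[T;T⁻¹]) (w : Stream' 𝓐) :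
    extend (g + h) w = extend g w + extend h w := by
  unfold extend
  split <;> simp

theorem extend_smul (c : R[T;T⁻¹]) (g : X → R[T;T⁻¹]) (w : Stream' 𝓐) :
    extend (c • g) w = c * extend g w := by
  unfold extend
  split <;> simp

variable (R X)

open Classical in
/-- The operator of `s_a`. -/
def opS (a : 𝓐) : Module.End R[T;T⁻¹] (X → R[T;T⁻¹]) where
  toFun g w := if (w : Stream' 𝓐).head = a then T 1 * extend g (w : Stream' 𝓐).tail else 0
  map_add' g h := by
    ext1 w
    simp only [extend_add, Pi.add_apply]
    split <;> ring
  map_smul' c g := by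
    ext1 w
    simp only [extend_smul, Pi.smul_apply, smul_eq_mul, RingHom.id_apply]
    split <;> ring

/-- The operator of `s_a^*`. -/
def opSd (a : 𝓐) : Module.End R[T;T⁻¹] (X → R[T;T⁻¹]) where
  toFun g w := T (-1) * extend g (Stream'.cons a w)
  map_add' g h := by
    ext1 w
    simp only [extend_add, Pi.add_apply]
    ring
  map_smul' c g := by
    ext1 w
    simp only [extend_smul, Pi.smul_apply, smul_eq_mul, RingHom.id_apply]
    ring

open Classical in
/-- The operator of `p_A`. -/
def opP (A : Set X) : Module.End R[T;T⁻¹] (X → R[T;T⁻¹]) where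
  toFun g w := if w ∈ A then g w else 0
  map_add' g h := by
    ext1 w
    simp only [Pi.add_apply]
    split <;> simp
  map_smul' c g := by
    ext1 w
    simp only [Pi.smul_apply, smul_eq_mul, RingHom.id_apply]
    split <;> simp

/-- The action of the generators. -/
def opGen : Gen X → Module.End R[T;T⁻¹] (X → R[T;T⁻¹])
  | .p A => opP R X A
  | .s a => opS R X a
  | .sStar a => opSd R X a

/-- The representation of the free algebra. -/
def repFree : Free R X →ₐ[R] Module.End R[T;T⁻¹] (X → R[T;T⁻¹]) :=
  FreeAlgebra.lift R (opGen R X)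

variable {R X}

theorem repFree_fp (A : boolAlg X) : repFree R X (fp R X A) = opP R X A :=
  FreeAlgebra.lift_ι_apply _ _

theorem repFree_fs (a : 𝓐) : repFree R X (fs R X a) = opS R X a :=
  FreeAlgebra.lift_ι_apply _ _

theorem repFree_fsStar (a : 𝓐) : repFree R X (fsStar R X a) = opSd R X a :=
  FreeAlgebra.lift_ι_apply _ _

open Classical in
theorem opP_apply (A : Set X) (g : X → R[T;T⁻¹]) (w : X) :
    opP R X A g w = if w ∈ A then g w else 0 := rfl

open Classical in
theorem opS_apply (a : 𝓐) (g : X → R[T;T⁻¹]) (w : X) :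
    opS R X a g w =
      if (w : Stream' 𝓐).head = a then T 1 * extend g (w : Stream' 𝓐).tail else 0 := rfl

variable (hX : IsFull X)
include hX

theorem repFree_fsWord_append (α : List 𝓐) (g : X → R[T;T⁻¹]) {w z : X}
    (h : (w : Stream' 𝓐) = α ++ₛ (z : Stream' 𝓐)) :
    repFree R X (fsWord R X α) g w = T α.length * g z := by
  induction α generalizing w with
  | nil => simp [fsWord, Subtype.ext h]
  | cons a α ih =>
    have hm : α ++ₛ (z : Stream' 𝓐) ∈ X := by
      have hw := w.2
      rw [h] at hw
      exact hX.tail_mem _ hw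
    have ht : (w : Stream' 𝓐).tail = α ++ₛ (z : Stream' 𝓐) := by rw [h]; rfl
    have hh : (w : Stream' 𝓐).head = a := by rw [h]; rfl
    have : repFree R X (fsWord R X (a :: α)) =
        opS R X a * repFree R X (fsWord R X α) := by
      rw [← repFree_fs, ← map_mul]
      simp [fsWord]
    rw [this, Module.End.mul_apply, opS_apply, if_pos hh, ht, extend_of_mem _ hm, ih rfl, ← mul_assoc, ← LaurentPolynomial.T_add]
    congr 2
    push_cast [List.length_cons]
    ring

omit hX in
theorem repFree_fsWord_ne (α : List 𝓐) (g : X → R[T;T⁻¹]) {w : X}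
    (h : ∀ z : X, (w : Stream' 𝓐) ≠ α ++ₛ (z : Stream' 𝓐)) :
    repFree R X (fsWord R X α) g w = 0 := by
  induction α generalizing w with
  | nil => exact absurd rfl (h w)
  | cons a α ih =>
    have : repFree R X (fsWord R X (a :: α)) =
        opS R X a * repFree R X (fsWord R X α) := by
      rw [← repFree_fs, ← map_mul]
      simp [fsWord]
    rw [this, Module.End.mul_apply, opS_apply]
    split_ifs with hh
    · by_cases hm : (w : Stream' 𝓐).tail ∈ X
      · rw [extend_of_mem _ hm, ih, mul_zero]
        intro z hz
        refine h z ?_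
        rw [← Stream'.eta (w : Stream' 𝓐), hh, Stream'.cons_append_stream, ← hz]
      · rw [extend_of_notMem _ hm, mul_zero]
    · rfl

theorem repFree_fsStarWord (α : List 𝓐) (g : X → R[T;T⁻¹]) (w : X) :
    repFree R X (fsStarWord R X α) g w = T (-(α.length : ℤ)) * extend g (α ++ₛ (w : Stream' 𝓐)) := by
  induction α generalizing g with
  | nil => simp [fsStarWord, extend_coe]
  | cons a α ih =>
    have : repFree R X (fsStarWord R X (a :: α)) =
        repFree R X (fsStarWord R X α) * opSd R X a := by
      rw [← repFree_fsStar, ← map_mul]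
      simp [fsStarWord]
    rw [this]
    change repFree R X (fsStarWord R X α) (opSd R X a g) w = _
    rw [ih]
    by_cases hm : α ++ₛ (w : Stream' 𝓐) ∈ X
    · rw [extend_of_mem _ hm]
      change _ * (T (-1) * extend g (Stream'.cons a (α ++ₛ (w : Stream' 𝓐)))) = _
      rw [Stream'.cons_append_stream, ← mul_assoc, ← LaurentPolynomial.T_add]
      congr 2
      push_cast [List.length_cons]
      ring
    · rw [extend_of_notMem _ hm, extend_of_notMem g (w := (a :: α) ++ₛ (w : Stream' 𝓐))
        fun h => hm (hX.tail_mem _ h), mul_zero, mul_zero]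

/-- Every relation is homogeneous for the degrees `1` of `s_a`, `-1` of `s_a^*` and `0` of `p_A`, so
the powers of `T` cancel. What remains is to check which sequences lie in `X`. -/
theorem repFree_rel ⦃f g : Free R X⦄ (h : Rel R X f g) : repFree R X f = repFree R X g := by
  have hs : ∀ a : 𝓐, fs R X a = fsWord R X [a] := fun a => by simp [fsWord]
  have hd : ∀ a : 𝓐, fsStar R X a = fsStarWord R X [a] := fun a => by simp [fsStarWord]
  have hcancel : ∀ (n : ℤ) (c : R[T;T⁻¹]), T n * (T (-n) * c) = c := fun n c => by
    rw [← mul_assoc, ← LaurentPolynomial.T_add, add_neg_cancel, LaurentPolynomial.T_zero, one_mul]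
  have hcancel' : ∀ (n : ℤ) (c : R[T;T⁻¹]), T (-n) * (T n * c) = c := fun n c => by
    rw [← mul_assoc, ← LaurentPolynomial.T_add, neg_add_cancel, LaurentPolynomial.T_zero, one_mul]
  refine LinearMap.ext fun g => funext fun w => ?_
  cases h with
  | p_top =>
    rw [repFree_fp, map_one, opP_apply, if_pos (by trivial)]
    rfl
  | p_bot =>
    rw [repFree_fp, map_zero, opP_apply, if_neg (by exact fun h => h)]
    rfl
  | p_inf A B =>
    rw [map_mul, repFree_fp, repFree_fp, repFree_fp, Module.End.mul_apply, opP_apply, opP_apply,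
      opP_apply]
    by_cases hA : w ∈ (A : Set X) <;> by_cases hB : w ∈ (B : Set X) <;> simp [hA, hB]
  | p_sup A B =>
    rw [map_sub, map_add, repFree_fp, repFree_fp, repFree_fp, repFree_fp]
    change _ = opP R X A g w + opP R X B g w - opP R X (A ⊓ B : boolAlg X) g w
    rw [opP_apply, opP_apply, opP_apply, opP_apply]
    by_cases hA : w ∈ (A : Set X) <;> by_cases hB : w ∈ (B : Set X) <;> simp [hA, hB]
  | s_sStar_s a =>
    rw [hs, hd, map_mul, map_mul, Module.End.mul_apply, Module.End.mul_apply]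
    by_cases hw : ∃ z : X, (w : Stream' 𝓐) = [a] ++ₛ (z : Stream' 𝓐)
    · obtain ⟨z, hz⟩ := hw
      rw [repFree_fsWord_append hX _ _ hz, repFree_fsStarWord hX, ← hz, extend_coe, hcancel]
    · push Not at hw
      rw [repFree_fsWord_ne _ _ hw, repFree_fsWord_ne _ _ hw]
  | sStar_s_sStar a =>
    rw [hs, hd, map_mul, map_mul, Module.End.mul_apply, Module.End.mul_apply,
      repFree_fsStarWord hX]
    by_cases hw : [a] ++ₛ (w : Stream' 𝓐) ∈ X
    · rw [extend_of_mem _ hw, repFree_fsWord_append hX _ _ rfl, hcancel']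
    · rw [extend_of_notMem _ hw, mul_zero, repFree_fsStarWord hX, extend_of_notMem _ hw, mul_zero]
  | word α β hα hβ =>
    rw [map_mul, map_mul, map_mul, Module.End.mul_apply, Module.End.mul_apply,
      Module.End.mul_apply, repFree_fp, opP_apply]
    by_cases hw : ∃ z : X, (w : Stream' 𝓐) = β ++ₛ (z : Stream' 𝓐)
    · obtain ⟨z, hz⟩ := hw
      rw [repFree_fsWord_append hX _ _ hz, repFree_fsStarWord hX]
      by_cases hαz : α ++ₛ (z : Stream' 𝓐) ∈ X
      · rw [extend_of_mem _ hαz, repFree_fsWord_append hX _ _ rfl, hcancel',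
          repFree_fsStarWord hX, ← hz, extend_coe, hcancel, if_pos]
        exact ⟨z, hz, hαz⟩
      · rw [extend_of_notMem _ hαz, mul_zero, mul_zero, if_neg]
        rintro ⟨z', hz', h⟩
        rw [hz, Stream'.append_right_inj] at hz'
        exact hαz (hz' ▸ h)
    · push Not at hw
      rw [repFree_fsWord_ne _ _ hw, if_neg]
      rintro ⟨z, hz, h⟩
      exact hw ⟨z, hX.of_append_mem (hz ▸ w.2)⟩ hz

variable (R) in
/-- The representation of the subshift algebra on functions with values in the Laurent
polynomials. -/
def rep : Alg R X →ₐ[R] Module.End R[T;T⁻¹] (X → R[T;T⁻¹]) :=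
  RingQuot.liftAlgHom R ⟨repFree R X, repFree_rel hX⟩

theorem rep_mk (f : Free R X) :
    rep R hX (RingQuot.mkAlgHom R (Rel R X) f) = repFree R X f :=
  RingQuot.liftAlgHom_mkAlgHom_apply _ _ _ _

open Classical in
theorem rep_pp {A : Set X} (hA : A ∈ boolAlg X) (g : X → R[T;T⁻¹]) (w : X) :
    rep R hX (pp R X A) g w = if w ∈ A then g w else 0 := by
  rw [pp_of_mem hA, proj, rep_mk, repFree_fp]
  rfl

theorem rep_ss_append (α : List 𝓐) (g : X → R[T;T⁻¹]) {w z : X}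
    (h : (w : Stream' 𝓐) = α ++ₛ (z : Stream' 𝓐)) :
    rep R hX (ss R X α) g w = T α.length * g z := by
  rw [ss, rep_mk, repFree_fsWord_append hX α g h]

theorem rep_ss_ne (α : List 𝓐) (g : X → R[T;T⁻¹]) {w : X}
    (h : ∀ z : X, (w : Stream' 𝓐) ≠ α ++ₛ (z : Stream' 𝓐)) :
    rep R hX (ss R X α) g w = 0 := by
  rw [ss, rep_mk, repFree_fsWord_ne α g h]

theorem rep_sd (α : List 𝓐) (g : X → R[T;T⁻¹]) (w : X) :
    rep R hX (sd R X α) g w = T (-(α.length : ℤ)) * extend g (α ++ₛ (w : Stream' 𝓐)) := by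
  rw [sd, rep_mk, repFree_fsStarWord hX]

theorem pp_ne_zero [Nontrivial R] {A : Set X} (hA : A ∈ boolAlg X) (h : A.Nonempty) :
    pp R X A ≠ 0 := by
  classical
  obtain ⟨x, hx⟩ := h
  intro h0
  have := rep_pp (R := R) hX hA 1 x
  rw [h0, map_zero, if_pos hx] at this
  exact zero_ne_one this

/-! ### Matrix coefficients of the representation. -/

open Classical in
variable (R) in
/-- The matrix coefficients of the representation. -/
def coef (z y : X) : Alg R X →ₗ[R] R[T;T⁻¹] where
  toFun a := rep R hX a (Pi.single y 1) z
  map_add' a b := by rw [map_add]; rfl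
  map_smul' r a := by rw [map_smul]; rfl

open Classical in
theorem coef_apply (z y : X) (a : Alg R X) : coef R hX z y a = rep R hX a (Pi.single y 1) z := rfl

omit hX in
theorem extend_single [DecidableEq X] (y : X) (w : Stream' 𝓐) (h : (y : Stream' 𝓐) ≠ w) :
    extend (Pi.single y (1 : R[T;T⁻¹])) w = 0 := by
  by_cases hw : w ∈ X
  · rw [extend_of_mem _ hw, Pi.single_eq_of_ne]
    rintro rfl
    exact h rfl
  · exact extend_of_notMem _ hw

/-- The coefficients of a monomial. -/
theorem coef_mon (z y : X) (α β : List 𝓐) {A : Set X} (hA : A ∈ boolAlg X) :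
    coef R hX z y (mon R X α A β) = 0 ∨
      (∃ x : X, (y : Stream' 𝓐) = β ++ₛ (x : Stream' 𝓐) ∧ (z : Stream' 𝓐) = α ++ₛ (x : Stream' 𝓐)) ∧
        coef R hX z y (mon R X α A β) = T ((α.length : ℤ) - β.length) := by
  classical
  rw [coef_apply, mon, map_mul, map_mul, Module.End.mul_apply, Module.End.mul_apply]
  by_cases hz : ∃ x : X, (z : Stream' 𝓐) = α ++ₛ (x : Stream' 𝓐)
  · obtain ⟨x, hz⟩ := hz
    rw [rep_ss_append hX α _ hz, rep_pp hX hA]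
    split_ifs with hxA
    · rw [rep_sd]
      by_cases hy : (y : Stream' 𝓐) = β ++ₛ (x : Stream' 𝓐)
      · refine Or.inr ⟨⟨x, hy, hz⟩, ?_⟩
        rw [← hy, extend_coe]
        convert (LaurentPolynomial.T_sub (R := R) (α.length : ℤ) β.length).symm using 2
        simp
      · left
        convert mul_zero _
        convert mul_zero _
        convert extend_single y _ hy
    · simp
  · push Not at hz
    exact Or.inl (rep_ss_ne hX _ _ hz)

/-- The coefficient of a conjugate. -/
theorem coef_sd_mul_ss (α β : List 𝓐) (a : Alg R X) {x y y' : X}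
    (hy : (y : Stream' 𝓐) = α ++ₛ (x : Stream' 𝓐)) (hy' : (y' : Stream' 𝓐) = β ++ₛ (x : Stream' 𝓐)) :
    coef R hX x x (sd R X α * a * ss R X β) =
      T (-(α.length : ℤ)) * (T β.length * coef R hX y y' a) := by
  classical
  have : rep R hX (ss R X β) (Pi.single x 1) = (T β.length : R[T;T⁻¹]) • Pi.single y' 1 := by
    ext1 w
    rw [Pi.smul_apply, smul_eq_mul]
    by_cases hw : ∃ z : X, (w : Stream' 𝓐) = β ++ₛ (z : Stream' 𝓐)
    · obtain ⟨z, hz⟩ := hw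
      rw [rep_ss_append hX β _ hz]
      congr 1
      by_cases hzx : z = x
      · subst hzx
        have : w = y' := Subtype.ext (hz.trans hy'.symm)
        rw [this, Pi.single_eq_same, Pi.single_eq_same]
      · rw [Pi.single_eq_of_ne hzx, Pi.single_eq_of_ne]
        rintro rfl
        rw [hy', Stream'.append_right_inj] at hz
        exact hzx (Subtype.ext hz.symm)
    · push Not at hw
      rw [rep_ss_ne hX _ _ hw, Pi.single_eq_of_ne, mul_zero]
      rintro rfl
      exact hw x hy'
  rw [coef_apply, coef_apply, map_mul, map_mul, Module.End.mul_apply, Module.End.mul_apply]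
  convert_to rep R hX (sd R X α) (rep R hX a (rep R hX (ss R X β) (Pi.single x 1))) x = _
  rw [this, map_smul, rep_sd, ← hy, extend_coe]
  rfl

theorem coef_ss_mul_sd (α β : List 𝓐) {f : Alg R X} {D : Set X} (hD : D ∈ boolAlg X) {r : R}
    (hf : pp R X D * f = r • pp R X D) {x y y' : X} (hx : x ∈ D)
    (hy : (y : Stream' 𝓐) = α ++ₛ (x : Stream' 𝓐)) (hy' : (y' : Stream' 𝓐) = β ++ₛ (x : Stream' 𝓐)) :
    coef R hX y y' (ss R X α * f * sd R X β) = r • T ((α.length : ℤ) - β.length) := by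
  classical
  have h1 : ∀ g : X → R[T;T⁻¹], rep R hX f g x = r • g x := by
    intro g
    have := congrArg (fun a => rep R hX a g x) hf
    simp only [map_mul, map_smul, Module.End.mul_apply, LinearMap.smul_apply,
      Pi.smul_apply, rep_pp hX hD, if_pos hx] at this
    exact this
  rw [coef_apply, map_mul, map_mul, Module.End.mul_apply, Module.End.mul_apply,
    rep_ss_append hX α _ hy, h1, rep_sd, ← hy', extend_coe]
  rw [mul_smul_comm, LaurentPolynomial.T_sub]
  congr 2
  simp

/-- As `d = p_{x} d`, it sends the indicator of `x` to a Laurent multiple of itself, and the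
operator of `c` is linear over Laurent polynomials. -/
theorem coef_mul_of_pt {x : X} (hx : {x} ∈ boolAlg X) (c d : Alg R X)
    (hd : pp R X {x} * d = d) : coef R hX x x (c * d) = coef R hX x x c * coef R hX x x d := by
  classical
  have : rep R hX d (Pi.single x 1) = coef R hX x x d • Pi.single x 1 := by
    ext1 w
    rw [Pi.smul_apply, smul_eq_mul]
    conv_lhs => rw [← hd, map_mul, Module.End.mul_apply, rep_pp hX hx]
    by_cases hw : w = x
    · subst hw
      rw [if_pos (Set.mem_singleton _), Pi.single_eq_same, mul_one, coef_apply]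
    · rw [if_neg (by simpa using hw), Pi.single_eq_of_ne hw, mul_zero]
  rw [coef_apply hX x x (c * d), map_mul, Module.End.mul_apply]
  convert_to rep R hX c (rep R hX d (Pi.single x 1)) x = _
  rw [this, map_smul, Pi.smul_apply, smul_eq_mul, mul_comm, coef_apply hX x x c]

end Rep

end

section

open scoped LaurentPolynomial

open LaurentPolynomial (T)

variable {𝓐 : Type u}

/-! ### Cylinders -/

theorem get_append_eq_of_agree {n : ℕ} {x y : Stream' 𝓐} (h : ∀ i < n, x.get i = y.get i)
    (γ : List 𝓐) : ∀ i < n, (γ ++ₛ x).get i = (γ ++ₛ y).get i := by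
  intro i hi
  rcases lt_or_ge i γ.length with hl | hl
  · rw [Stream'.get_append_left _ _ _ hl, Stream'.get_append_left _ _ _ hl]
  · obtain ⟨j, rfl⟩ := Nat.exists_eq_add_of_le hl
    rw [Stream'.get_append_right, Stream'.get_append_right]
    exact h j (by omega)

/-- The condition on `x` is closed: `y` must be the tail of `β'x` after `|β|` letters, and each
required equality of letters depends on a finite prefix of `x`. -/
theorem exists_append_eq_of_agree {α β α' β' : List 𝓐} {x : Stream' 𝓐}
    (h : ∀ n : ℕ, ∃ w z z' : Stream' 𝓐, α' ++ₛ z = α ++ₛ w ∧ β' ++ₛ z' = β ++ₛ w ∧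
      (∀ i < n, z.get i = x.get i) ∧ ∀ i < n, z'.get i = x.get i) :
    ∃ y, β' ++ₛ x = β ++ₛ y ∧ α' ++ₛ x = α ++ₛ y := by
  refine ⟨(β' ++ₛ x).drop β.length, ?_, ?_⟩
  · ext k
    rcases lt_or_ge k β.length with hl | hl
    · obtain ⟨w, z, z', -, hw', -, hz'⟩ := h (k + 1)
      rw [← get_append_eq_of_agree hz' β' k (by omega), hw', Stream'.get_append_left _ _ _ hl,
        Stream'.get_append_left _ _ _ hl]
    · obtain ⟨j, rfl⟩ := Nat.exists_eq_add_of_le hl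
      rw [Stream'.get_append_right, Stream'.get_drop]
  · ext k
    -- Letter `k` of `αw` may be a letter of `w`, which is read in `βw` at a position up to `|β| +
    -- k`.
    obtain ⟨w, z, z', hw, hw', hz, hz'⟩ := h (k + β.length + 1)
    rw [← get_append_eq_of_agree hz α' k (by omega), hw]
    rcases lt_or_ge k α.length with hl | hl
    · rw [Stream'.get_append_left _ _ _ hl, Stream'.get_append_left _ _ _ hl]
    · obtain ⟨j, rfl⟩ := Nat.exists_eq_add_of_le hl
      rw [Stream'.get_append_right, Stream'.get_append_right, Stream'.get_drop,
        ← get_append_eq_of_agree hz' β' (β.length + j) (by omega), hw', Stream'.get_append_right]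

/-- The points of `X` sharing the first `n` letters of `x`. -/
def cyl (X : Set (Stream' 𝓐)) (x : X) (n : ℕ) : Set X :=
  cylFol X [] ((x : Stream' 𝓐).take n)

variable {X : Set (Stream' 𝓐)}

theorem mem_cyl (hX : IsFull X) {x y : X} {n : ℕ} :
    y ∈ cyl X x n ↔ ∀ i < n, (y : Stream' 𝓐).get i = (x : Stream' 𝓐).get i := by
  constructor
  · rintro ⟨z, hz, -⟩ i hi
    rw [hz, Stream'.get_append_left _ _ _ (by simpa using hi), Stream'.take_get]
  · intro h
    refine ⟨(y : Stream' 𝓐).drop n, ?_, hX.drop_mem y.2 n⟩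
    have : (x : Stream' 𝓐).take n = (y : Stream' 𝓐).take n := by
      refine List.ext_getElem (by simp) fun i h1 h2 => ?_
      rw [Stream'.take_get, Stream'.take_get, h i (by simpa using h1)]
    rw [this, Stream'.append_take_drop]

theorem self_mem_cyl (hX : IsFull X) (x : X) (n : ℕ) : x ∈ cyl X x n :=
  (mem_cyl hX).2 fun _ _ => rfl

theorem cyl_mem_boolAlg (hX : IsFull X) (x : X) (n : ℕ) : cyl X x n ∈ boolAlg X :=
  cylFol_mem X hX.nil_mem ⟨x, x.2, n, rfl⟩

theorem cyl_anti (hX : IsFull X) (x : X) {m n : ℕ} (h : m ≤ n) : cyl X x n ⊆ cyl X x m :=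
  fun _ hy => (mem_cyl hX).2 fun i hi => (mem_cyl hX).1 hy i (hi.trans_le h)

theorem exists_notMem_cyl (hX : IsFull X) {x y : X} (h : y ≠ x) : ∃ n, y ∉ cyl X x n := by
  by_contra! hn
  exact h (Subtype.ext (Stream'.ext fun i => (mem_cyl hX).1 (hn (i + 1)) i (Nat.lt_succ_self i)))

theorem isolated_of_finite (hX : IsFull X) {D : Set X} (hD : D ∈ boolAlg X) (hf : D.Finite)
    {x : X} (hx : x ∈ D) : {x} ∈ boolAlg X := by
  have : ∀ y : X, ∃ n, y ≠ x → y ∉ cyl X x n := by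
    intro y
    by_cases h : y = x
    · exact ⟨0, fun h' => absurd h h'⟩
    · obtain ⟨n, hn⟩ := exists_notMem_cyl hX h
      exact ⟨n, fun _ => hn⟩
  choose n hn using this
  have he : {x} = D ∩ cyl X x (hf.toFinset.sup n) := by
    ext y
    rw [Set.mem_singleton_iff]
    constructor
    · rintro rfl
      exact ⟨hx, self_mem_cyl hX _ _⟩
    · rintro ⟨hy, hyc⟩
      by_contra hne
      exact hn y hne (cyl_anti hX x (Finset.le_sup (f := n) (hf.mem_toFinset.2 hy)) hyc)
  rw [he]
  exact inter_mem_boolAlg hD (cyl_mem_boolAlg hX _ _)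

variable {R : Type v} [CommRing R]

/-! ### Normal forms -/

section

variable (hX : IsFull X)
include hX

/-- A common suffix `γ` is absorbed into the projection, since `s_γ p_A s_γ^*` is the projection of
the image of `A` under prefixing by `γ`. -/
theorem exists_isReduced_mon (α β : List 𝓐) {A : Set X} (hA : A ∈ boolAlg X) :
    ∃ α' β', ∃ A' ∈ boolAlg X, IsReduced α' β' ∧ mon R X α A β = mon R X α' A' β' := by
  induction hn : α.length using Nat.strong_induction_on generalizing α β A with
  | _ n ih =>
    by_cases hr : IsReduced α β
    · exact ⟨α, β, A, hA, hr, rfl⟩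
    · unfold IsReduced at hr
      push Not at hr
      obtain ⟨α', β', γ, rfl, rfl, hγ⟩ := hr
      have hpos := List.length_pos_iff.2 hγ
      obtain ⟨α'', β'', A'', hA'', hr, he⟩ := ih α'.length (by simp at hn; omega) α' β'
        (img_mem hX γ hA) rfl
      refine ⟨α'', β'', A'', hA'', hr, ?_⟩
      rw [← he, mon, mon, ss_append, sd_append, ← ss_mul_pp_mul_sd hX γ hA]
      simp only [mul_assoc]

/-- Every element is a finite sum of terms `s_α f s_β^*` over reduced pairs `(α, β)`. -/
theorem mem_iSup_reduced (a : Alg R X) :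
    a ∈ ⨆ p : {p : List 𝓐 × List 𝓐 // IsReduced p.1 p.2},
      Submodule.span R {m | ∃ A ∈ boolAlg X, m = mon R X p.1.1 A p.1.2} := by
  refine Submodule.span_le.2 ?_ (mem_span_mon hX a)
  rintro _ ⟨α, A, hA, β, rfl⟩
  obtain ⟨α', β', A', hA', hr, he⟩ := exists_isReduced_mon (R := R) hX α β hA
  rw [he]
  exact Submodule.mem_iSup_of_mem ⟨(α', β'), hr⟩ (Submodule.subset_span ⟨A', hA', rfl⟩)

omit hX in
theorem exists_eq_ss_mul_sd {α β : List 𝓐} {m : Alg R X}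
    (hm : m ∈ Submodule.span R {m | ∃ A ∈ boolAlg X, m = mon R X α A β}) :
    ∃ f ∈ Submodule.span R {m | ∃ A ∈ boolAlg X, m = pp R X A},
      m = ss R X α * f * sd R X β := by
  induction hm using Submodule.span_induction with
  | mem m hm =>
    obtain ⟨A, hA, rfl⟩ := hm
    exact ⟨pp R X A, Submodule.subset_span ⟨A, hA, rfl⟩, rfl⟩
  | zero => exact ⟨0, zero_mem _, by simp⟩
  | add x y _ _ hx hy =>
    obtain ⟨f, hf, rfl⟩ := hx
    obtain ⟨g, hg, rfl⟩ := hy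
    exact ⟨f + g, add_mem hf hg, by rw [mul_add, add_mul]⟩
  | smul r x _ hx =>
    obtain ⟨f, hf, rfl⟩ := hx
    exact ⟨r • f, Submodule.smul_mem _ r hf, by rw [mul_smul_comm, smul_mul_assoc]⟩

omit hX in
theorem commute_of_mem_span_pp {f : Alg R X}
    (hf : f ∈ Submodule.span R {m | ∃ A ∈ boolAlg X, m = pp R X A}) {B : Set X}
    (hB : B ∈ boolAlg X) : pp R X B * f = f * pp R X B := by
  induction hf using Submodule.span_induction with
  | mem m hm =>
    obtain ⟨A, hA, rfl⟩ := hm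
    exact pp_comm hB hA
  | zero => simp
  | add x y _ _ hx hy => rw [mul_add, add_mul, hx, hy]
  | smul r x _ hx => rw [mul_smul_comm, smul_mul_assoc, hx]

omit hX in
/-- A combination of projections is constant on the pieces of a finite partition. -/
theorem exists_partition {f : Alg R X}
    (hf : f ∈ Submodule.span R {m | ∃ A ∈ boolAlg X, m = pp R X A}) :
    ∃ (ι : Type) (_ : Fintype ι) (D : ι → Set X), (∀ i, D i ∈ boolAlg X) ∧
      ∑ i, pp R X (D i) = 1 ∧ ∀ i, ∃ r : R, pp R X (D i) * f = r • pp R X (D i) := by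
  induction hf using Submodule.span_induction with
  | mem m hm =>
    obtain ⟨A, hA, rfl⟩ := hm
    refine ⟨Bool, inferInstance, fun b => if b then A else Aᶜ, ?_, ?_, ?_⟩
    · rintro (_ | _)
      exacts [BooleanSubalgebra.compl_mem hA, hA]
    · rw [Fintype.sum_bool]
      simp [pp_compl hA]
    · rintro (_ | _)
      · refine ⟨0, ?_⟩
        simp [pp_compl hA, sub_mul, pp_idem hA]
      · exact ⟨1, by simp [pp_idem hA]⟩
  | zero =>
    exact ⟨Unit, inferInstance, fun _ => Set.univ, fun _ => univ_mem_boolAlg X, by simp [pp_univ],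
      fun _ => ⟨0, by simp⟩⟩
  | add x y _ _ hx hy =>
    obtain ⟨ι, _, D, hD, hD1, hDr⟩ := hx
    obtain ⟨κ, _, E, hE, hE1, hEr⟩ := hy
    refine ⟨ι × κ, inferInstance, fun p => D p.1 ∩ E p.2,
      fun p => inter_mem_boolAlg (hD _) (hE _), ?_, ?_⟩
    · simp_rw [fun p : ι × κ => pp_inter (R := R) (hD p.1) (hE p.2)]
      rw [Fintype.sum_prod_type]
      change ∑ i, ∑ j, pp R X (D i) * pp R X (E j) = 1
      rw [← Finset.sum_mul_sum, hD1, hE1, mul_one]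
    · rintro ⟨i, j⟩
      obtain ⟨r, hr⟩ := hDr i
      obtain ⟨s, hs⟩ := hEr j
      refine ⟨r + s, ?_⟩
      change pp R X (D i ∩ E j) * _ = _ • pp R X (D i ∩ E j)
      rw [mul_add, add_smul]
      congr 1
      · rw [pp_inter (hD i) (hE j), pp_comm (hD i) (hE j), mul_assoc, hr, mul_smul_comm]
      · rw [pp_inter (hD i) (hE j), mul_assoc, hs, mul_smul_comm]
  | smul c x _ hx =>
    obtain ⟨ι, _, D, hD, hD1, hDr⟩ := hx
    refine ⟨ι, inferInstance, D, hD, hD1, fun i => ?_⟩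
    obtain ⟨r, hr⟩ := hDr i
    exact ⟨c * r, by rw [mul_smul_comm, hr, smul_smul]⟩

/-- A nonzero term `s_α f s_β^*` is a nonzero scalar on some set. -/
theorem exists_const_of_ne_zero {α β : List 𝓐} {f : Alg R X}
    (hf : f ∈ Submodule.span R {m | ∃ A ∈ boolAlg X, m = pp R X A})
    (h : ss R X α * f * sd R X β ≠ 0) :
    ∃ D ∈ boolAlg X, D.Nonempty ∧ D ⊆ pre X α Set.univ ∧ D ⊆ pre X β Set.univ ∧
      ∃ r : R, r ≠ 0 ∧ pp R X D * f = r • pp R X D := by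
  have hα := pre_mem hX α (univ_mem_boolAlg X)
  have hβ := pre_mem hX β (univ_mem_boolAlg X)
  have hC := inter_mem_boolAlg hα hβ
  obtain ⟨ι, _, D, hD, hD1, hDr⟩ := exists_partition hf
  have hCf : pp R X (pre X α Set.univ ∩ pre X β Set.univ) * f ≠ 0 := by
    intro h0
    apply h
    calc ss R X α * f * sd R X β
        = ss R X α * pp R X (pre X α Set.univ) * f * (pp R X (pre X β Set.univ) * sd R X β) := by
          rw [ss_mul_pp_pre_univ hX, pp_pre_univ_mul_sd hX]
      _ = ss R X α * pp R X (pre X α Set.univ) * (f * pp R X (pre X β Set.univ)) * sd R X β := by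
          simp only [mul_assoc]
      _ = ss R X α * (pp R X (pre X α Set.univ) * pp R X (pre X β Set.univ) * f) * sd R X β := by
          rw [← commute_of_mem_span_pp hf hβ]
          simp only [mul_assoc]
      _ = 0 := by rw [← pp_inter hα hβ, h0, mul_zero, zero_mul]
  obtain ⟨i, hi⟩ : ∃ i, pp R X (D i) * (pp R X (pre X α Set.univ ∩ pre X β Set.univ) * f) ≠ 0 := by
    by_contra! h0
    apply hCf
    rw [← one_mul (pp R X _ * f), ← hD1, Finset.sum_mul, Finset.sum_eq_zero fun i _ => h0 i]
  obtain ⟨r, hr⟩ := hDr i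
  have hE : pp R X (D i ∩ (pre X α Set.univ ∩ pre X β Set.univ)) * f =
      r • pp R X (D i ∩ (pre X α Set.univ ∩ pre X β Set.univ)) := by
    rw [pp_inter (hD i) hC, pp_comm (hD i) hC, mul_assoc, hr, mul_smul_comm]
  rw [← mul_assoc, ← pp_inter (hD i) hC, hE] at hi
  refine ⟨_, inter_mem_boolAlg (hD i) hC, ?_, fun x hx => hx.2.1, fun x hx => hx.2.2, r, ?_, hE⟩
  · rw [Set.nonempty_iff_ne_empty]
    intro h0
    rw [h0, pp_empty, smul_zero] at hi
    exact hi rfl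
  · rintro rfl
    rw [zero_smul] at hi
    exact hi rfl

/-! ### Separating monomials -/

omit hX in
theorem pre_img (α : List 𝓐) (B : Set X) : pre X α (img X α B) = pre X α Set.univ ∩ B := by
  ext x
  constructor
  · rintro ⟨y, ⟨z, hz, hy⟩, hx⟩
    refine ⟨⟨y, trivial, hx⟩, ?_⟩
    rw [hy, Stream'.append_right_inj] at hx
    rwa [← Subtype.ext hx]
  · rintro ⟨⟨y, -, hy⟩, hx⟩
    exact ⟨y, ⟨x, hx, hy⟩, hy⟩

theorem pp_mul_sd_eq (α : List 𝓐) {B : Set X} (hB : B ∈ boolAlg X) :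
    pp R X B * sd R X α = sd R X α * pp R X (img X α B) := by
  have hu := pre_mem hX α (univ_mem_boolAlg X)
  rw [sd_mul_pp hX α (img_mem hX α hB), pre_img, pp_inter hu hB, pp_comm hu hB, mul_assoc,
    pp_pre_univ_mul_sd hX]

theorem ss_mul_pp_eq (α : List 𝓐) {B : Set X} (hB : B ∈ boolAlg X) :
    ss R X α * pp R X B = pp R X (img X α B) * ss R X α := by
  rw [pp_mul_ss hX α (img_mem hX α hB), pre_img,
    pp_inter (pre_mem hX α (univ_mem_boolAlg X)) hB, ← mul_assoc, ss_mul_pp_pre_univ hX]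

theorem mon_mul_pp {A B : Set X} (hA : A ∈ boolAlg X) (hB : B ∈ boolAlg X) (α β : List 𝓐) :
    mon R X α A β * pp R X B = mon R X α (A ∩ pre X β B) β := by
  rw [mon, mon, pp_inter hA (pre_mem hX β hB), mul_assoc, sd_mul_pp hX β hB]
  simp only [mul_assoc]

/-- Conjugating `s_α p_A s_β^*` by `s_α'^*` and `s_β'` and cutting to a cylinder gives `0` once no
`w` has both `αw` and `βw` in the images of the cylinder under `α'` and `β'`. If this failed for
every cylinder around `x`, closedness would produce the excluded `y`. -/
theorem exists_cyl_separating {α β α' β' : List 𝓐} {x : X}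
    (h : ¬ ∃ y, β' ++ₛ (x : Stream' 𝓐) = β ++ₛ y ∧ α' ++ₛ (x : Stream' 𝓐) = α ++ₛ y) :
    ∃ n, ∀ m ∈ Submodule.span R {m | ∃ A ∈ boolAlg X, m = mon R X α A β},
      pp R X (cyl X x n) * (sd R X α' * m * ss R X β') * pp R X (cyl X x n) = 0 := by
  obtain ⟨n, hn⟩ : ∃ n, pre X α (img X α' (cyl X x n)) ∩ pre X β (img X β' (cyl X x n)) = ∅ := by
    by_contra! hne
    refine h (exists_append_eq_of_agree fun n => ?_)
    obtain ⟨w, ⟨y, ⟨z, hz, hy⟩, hw⟩, ⟨y', ⟨z', hz', hy'⟩, hw'⟩⟩ := hne n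
    exact ⟨w, z, z', hy ▸ hw, hy' ▸ hw', (mem_cyl hX).1 hz, (mem_cyl hX).1 hz'⟩
  refine ⟨n, fun m hm => ?_⟩
  have hZ := cyl_mem_boolAlg hX x n
  induction hm using Submodule.span_induction with
  | mem m hm =>
    obtain ⟨A, hA, rfl⟩ := hm
    have hα := img_mem hX α' hZ
    have hβ := img_mem hX β' hZ
    have hp := pre_mem hX α hα
    calc _ = pp R X (cyl X x n) * sd R X α' * mon R X α A β *
            (ss R X β' * pp R X (cyl X x n)) := by simp only [mul_assoc]
      _ = sd R X α' * (pp R X (img X α' (cyl X x n)) * mon R X α A β *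
            pp R X (img X β' (cyl X x n))) * ss R X β' := by
          rw [pp_mul_sd_eq hX α' hZ, ss_mul_pp_eq hX β' hZ]
          simp only [mul_assoc]
      _ = 0 := by
          rw [pp_mul_mon hX hA hα, mon_mul_pp hX (inter_mem_boolAlg hp hA) hβ,
            Set.inter_right_comm, hn, Set.empty_inter, mon, pp_empty, mul_zero, zero_mul,
            mul_zero, zero_mul]
  | zero => simp
  | add a b _ _ ha hb => rw [mul_add, add_mul, mul_add, add_mul, ha, hb, add_zero]
  | smul r a _ ha =>
    rw [mul_smul_comm, smul_mul_assoc, mul_smul_comm, smul_mul_assoc, ha, smul_zero]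

theorem coef_eq_zero_of_not_exists {α β : List 𝓐} {z y : X}
    (h : ¬ ∃ x : X, (y : Stream' 𝓐) = β ++ₛ (x : Stream' 𝓐) ∧
      (z : Stream' 𝓐) = α ++ₛ (x : Stream' 𝓐)) {m : Alg R X}
    (hm : m ∈ Submodule.span R {m | ∃ A ∈ boolAlg X, m = mon R X α A β}) :
    coef R hX z y m = 0 := by
  induction hm using Submodule.span_induction with
  | mem m hm =>
    obtain ⟨A, hA, rfl⟩ := hm
    exact (coef_mon hX z y α β hA).resolve_right fun h' => h h'.1
  | zero => simp
  | add a b _ _ ha hb => rw [map_add, ha, hb, add_zero]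
  | smul r a _ ha => rw [map_smul, ha, smul_zero]

theorem coeff_coef_eq_zero {α β : List 𝓐} (z y : X) {n : ℤ} (h : (α.length : ℤ) - β.length ≠ n)
    {m : Alg R X}
    (hm : m ∈ Submodule.span R {m | ∃ A ∈ boolAlg X, m = mon R X α A β}) :
    (coef R hX z y m).coeff n = 0 := by
  induction hm using Submodule.span_induction with
  | mem m hm =>
    obtain ⟨A, hA, rfl⟩ := hm
    obtain h0 | ⟨-, h1⟩ := coef_mon (R := R) hX z y α β hA
    · rw [h0]; simp
    · rw [h1, LaurentPolynomial.T_apply, if_neg h]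
  | zero => simp
  | add a b _ _ ha hb => rw [map_add, AddMonoidAlgebra.coeff_add, Finsupp.add_apply, ha, hb,
      add_zero]
  | smul r a _ ha => rw [map_smul, AddMonoidAlgebra.coeff_smul, Finsupp.smul_apply, ha, smul_zero]

end

end

section

open scoped LaurentPolynomial

open LaurentPolynomial (T)

variable {𝓐 : Type u} {X : Set (Stream' 𝓐)}

/-! ### Compression to a projection or to the corner of an isolated point. -/

section

variable {R : Type v} [CommRing R] (hX : IsFull X)
include hX

theorem sd_mul_ss_mul_mul {α β : List 𝓐} {D : Set X} (hD : D ∈ boolAlg X)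
    (hα : D ⊆ pre X α Set.univ) (hβ : D ⊆ pre X β Set.univ) {f : Alg R X} {r : R}
    (hr : pp R X D * f = r • pp R X D) {E : Set X} (hE : E ∈ boolAlg X) (hED : E ⊆ D) :
    pp R X E * (sd R X α * (ss R X α * f * sd R X β) * ss R X β) * pp R X E = r • pp R X E := by
  have hsub : ∀ {A B : Set X}, A ∈ boolAlg X → B ∈ boolAlg X → A ⊆ B →
      pp R X A * pp R X B = pp R X A := fun hA hB h => by
    rw [← pp_inter hA hB, Set.inter_eq_left.2 h]
  have hu := univ_mem_boolAlg X
  calc _ = pp R X E * (sd R X α * ss R X α) * f * (sd R X β * ss R X β) * pp R X E := by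
        simp only [mul_assoc]
    _ = pp R X E * f * (pp R X E * pp R X (pre X β Set.univ)) := by
        rw [sd_mul_ss hX, sd_mul_ss hX, hsub hE (pre_mem hX α hu) (hED.trans hα), mul_assoc,
          pp_comm (pre_mem hX β hu) hE]
    _ = pp R X E * (pp R X D * f) * pp R X E := by
        rw [hsub hE (pre_mem hX β hu) (hED.trans hβ), ← mul_assoc, hsub hE hD hED]
    _ = r • pp R X E := by
        rw [hr, mul_smul_comm, smul_mul_assoc, hsub hE hD hED, pp_idem hE]

/-- Every nonzero element can be compressed to a multiple of a nonzero projection, or into the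
corner of an isolated point. -/
theorem exists_reduction {a : Alg R X} (ha : a ≠ 0) :
    ∃ b c : Alg R X, (∃ E ∈ boolAlg X, E.Nonempty ∧ ∃ r : R, r ≠ 0 ∧ b * a * c = r • pp R X E) ∨
      ∃ x : X, {x} ∈ boolAlg X ∧ pp R X {x} * (b * a * c) = b * a * c ∧
        b * a * c * pp R X {x} = b * a * c ∧ coef R hX x x (b * a * c) ≠ 0 := by
  classical
  obtain ⟨μ, hμ, hsum⟩ := (Submodule.mem_iSup_iff_exists_finsupp _ _).1 (mem_iSup_reduced hX a)
  obtain ⟨p, hp⟩ : ∃ p, μ p ≠ 0 := by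
    by_contra! h
    apply ha
    rw [← hsum, Finsupp.sum, Finset.sum_eq_zero fun i _ => h i]
  obtain ⟨⟨α, β⟩, hred⟩ := p
  replace hred : IsReduced α β := hred
  set p : {p : List 𝓐 × List 𝓐 // IsReduced p.1 p.2} := ⟨(α, β), hred⟩
  obtain ⟨f, hf, hpf⟩ := exists_eq_ss_mul_sd (hμ p)
  change μ p = ss R X α * f * sd R X β at hpf
  rw [hpf] at hp
  obtain ⟨D, hD, ⟨x₁, hx₁⟩, hDα, hDβ, r, hr, hDf⟩ := exists_const_of_ne_zero hX hf hp
  have hmem : p ∈ μ.support := by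
    rw [Finsupp.mem_support_iff, hpf]
    exact hp
  have hsum' : a = ∑ i ∈ μ.support, μ i := hsum.symm
  -- These are the points where the term `i` cannot be separated from the chosen term by a cylinder.
  set bad : {p : List 𝓐 × List 𝓐 // IsReduced p.1 p.2} → Set X := fun i =>
    {x | ∃ y, β ++ₛ (x : Stream' 𝓐) = i.1.2 ++ₛ y ∧ α ++ₛ (x : Stream' 𝓐) = i.1.1 ++ₛ y}
  by_cases hgood : ∃ x ∈ D, ∀ i ∈ μ.support.erase p, x ∉ bad i
  · obtain ⟨x, hxD, hx⟩ := hgood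
    have : ∀ i, ∃ n, i ∈ μ.support.erase p →
        pp R X (cyl X x n) * (sd R X α * μ i * ss R X β) * pp R X (cyl X x n) = 0 := by
      intro i
      by_cases hi : i ∈ μ.support.erase p
      · obtain ⟨n, hn⟩ := exists_cyl_separating (R := R) hX (hx i hi)
        exact ⟨n, fun _ => hn _ (hμ i)⟩
      · exact ⟨0, fun h => absurd h hi⟩
    choose n hn using this
    set N := (μ.support.erase p).sup n
    set E := D ∩ cyl X x N
    have hEU : E ∈ boolAlg X := inter_mem_boolAlg hD (cyl_mem_boolAlg hX _ _)
    have hzero : ∀ i ∈ μ.support.erase p,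
        pp R X E * (sd R X α * μ i * ss R X β) * pp R X E = 0 := by
      intro i hi
      have hZ := cyl_mem_boolAlg hX x (n i)
      have hsub : E ⊆ cyl X x (n i) :=
        Set.inter_subset_right.trans (cyl_anti hX x (Finset.le_sup (f := n) hi))
      have h1 : pp R X E = pp R X E * pp R X (cyl X x (n i)) := by
        rw [← pp_inter hEU hZ, Set.inter_eq_left.2 hsub]
      have h2 : pp R X E = pp R X (cyl X x (n i)) * pp R X E := by
        rw [pp_comm hZ hEU, ← h1]
      calc _ = pp R X E * pp R X (cyl X x (n i)) * (sd R X α * μ i * ss R X β) *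
              (pp R X (cyl X x (n i)) * pp R X E) := by rw [← h1, ← h2]
        _ = pp R X E * (pp R X (cyl X x (n i)) * (sd R X α * μ i * ss R X β) *
              pp R X (cyl X x (n i))) * pp R X E := by simp only [mul_assoc]
        _ = 0 := by rw [hn i hi, mul_zero, zero_mul]
    refine ⟨pp R X E * sd R X α, ss R X β * pp R X E, Or.inl ⟨E, hEU, ⟨x, hxD, self_mem_cyl hX _ _⟩,
      r, hr, ?_⟩⟩
    calc _ = ∑ i ∈ μ.support, pp R X E * (sd R X α * μ i * ss R X β) * pp R X E := by
          rw [hsum', Finset.mul_sum, Finset.sum_mul]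
          simp only [mul_assoc]
      _ = pp R X E * (sd R X α * μ p * ss R X β) * pp R X E := by
          rw [← Finset.add_sum_erase _ _ hmem, Finset.sum_eq_zero hzero, add_zero]
      _ = _ := by
          rw [hpf]
          exact sd_mul_ss_mul_mul hX hD hDα hDβ hDf hEU Set.inter_subset_left
  · push Not at hgood
    -- For `i ≠ p` a bad set has at most one point: equal degrees would give equal reduced pairs,
    -- and different degrees determine the point. Thus `D`, covered by finitely many of them, is
    -- finite.
    have hfin : D.Finite := by
      refine Set.Finite.subset (s := ⋃ i ∈ μ.support.erase p, bad i) ?_ fun x hx => ?_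
      · refine Set.Finite.biUnion (Finset.finite_toSet _) fun i hi => Set.Subsingleton.finite ?_
        rintro x ⟨y, hy, hy'⟩ z ⟨w, hw, hw'⟩
        refine Subtype.ext (eq_of_length_ne hy hy' hw hw' fun hl => ?_)
        obtain ⟨h1, h2⟩ := eq_of_isReduced i.2 hred hy hy' hl
        exact Finset.ne_of_mem_erase hi (Subtype.ext (Prod.ext h1 h2))
      · obtain ⟨i, hi, h⟩ := hgood x hx
        exact Set.mem_biUnion hi h
    have hxU := isolated_of_finite hX hD hfin hx₁
    obtain ⟨y, -, hy⟩ := hDα hx₁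
    obtain ⟨y', -, hy'⟩ := hDβ hx₁
    have hyU := isolated_append hX hy hxU
    have hyU' := isolated_append hX hy' hxU
    refine ⟨sd R X α * pp R X {y}, pp R X {y'} * ss R X β, Or.inr ⟨x₁, hxU, ?_, ?_, ?_⟩⟩
    · rw [sd_mul_pt hX hy hyU]
      simp only [← mul_assoc]
      rw [pp_idem hxU]
    · rw [pt_mul_ss hX hy' hyU', mul_assoc, mul_assoc (ss R X β), pp_idem hxU]
    · have hcoef : coef R hX y y' a ≠ 0 := by
        intro h0
        apply hr
        -- In degree `|α| - |β|` the chosen term contributes `r`. The others contribute nothing: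
        -- either their degree differs, or reducedness prevents them from linking `y'` to `y`.
        have h1 := congrArg (fun g : R[T;T⁻¹] => g.coeff ((α.length : ℤ) - β.length)) h0
        rw [hsum', ← Finset.add_sum_erase _ _ hmem, map_add, map_sum, hpf,
          coef_ss_mul_sd hX α β hD hDf hx₁ hy hy', AddMonoidAlgebra.coeff_add, Finsupp.add_apply,
          AddMonoidAlgebra.coeff_sum, Finsupp.finsetSum_apply, Finset.sum_eq_zero,
          AddMonoidAlgebra.coeff_smul, Finsupp.smul_apply, LaurentPolynomial.T_apply, if_pos rfl,
          smul_eq_mul, mul_one, add_zero] at h1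
        · simpa using h1
        · intro i hi
          by_cases hl : (i.1.1.length : ℤ) - i.1.2.length = (α.length : ℤ) - β.length
          · rw [coef_eq_zero_of_not_exists hX _ (hμ i)]
            · simp
            · rintro ⟨w, hw, hw'⟩
              rw [hy'] at hw
              rw [hy] at hw'
              obtain ⟨h1, h2⟩ := eq_of_isReduced i.2 hred hw hw' (by omega)
              exact Finset.ne_of_mem_erase hi (Subtype.ext (Prod.ext h1 h2))
          · exact coeff_coef_eq_zero hX y y' hl (hμ i)
      have hre : sd R X α * pp R X {y} * a * (pp R X {y'} * ss R X β) =
          sd R X α * (pp R X {y} * a * pp R X {y'}) * ss R X β := by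
        simp only [mul_assoc]
      have hpt : coef R hX y y' (pp R X {y} * a * pp R X {y'}) = coef R hX y y' a := by
        rw [coef_apply, coef_apply, map_mul, map_mul, Module.End.mul_apply, Module.End.mul_apply,
          rep_pp hX hyU, if_pos (Set.mem_singleton y)]
        have hs : rep R hX (pp R X {y'}) (Pi.single y' 1) = Pi.single y' 1 := by
          ext1 w
          rw [rep_pp hX hyU']
          split_ifs with hw
          · rfl
          · rw [Pi.single_eq_of_ne]
            simpa using hw
        rw [hs]
      rw [hre, coef_sd_mul_ss hX α β _ hy hy', hpt]
      intro h0
      have hu := LaurentPolynomial.isUnit_T (R := R)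
      exact hcoef ((hu _).mul_right_eq_zero.1 ((hu _).mul_right_eq_zero.1 h0))

end

/-! ### Minimal left ideals come from aperiodic isolated points. -/

section

variable {R : Type v} [Field R] (hX : IsFull X)
include hX

/-- An isolated point whose corner contains an element generating a minimal left ideal is
aperiodic. -/
theorem isAperiodic_of_left_inverse {x : X} (hx : {x} ∈ boolAlg X) {d : Alg R X}
    (hd : pp R X {x} * d = d) (hd0 : coef R hX x x d ≠ 0)
    (h : ∀ u, u * d ≠ 0 → ∃ v, v * (u * d) = d) : IsAperiodic (x : Stream' 𝓐) := by
  classical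
  intro α β hβ he
  -- This loop at `x = αβ^∞` has diagonal coefficient `T^|β|`. The minimality hypothesis applied to
  -- `(1 - t) d` would make `1 - T^|β|` invertible.
  set t : Alg R X := ss R X α * ss R X β * sd R X α with ht
  have hzX : Stream'.cycle β hβ ∈ X := hX.of_append_mem (he ▸ x.2)
  set z : X := ⟨Stream'.cycle β hβ, hzX⟩
  have hzz : (z : Stream' 𝓐) = β ++ₛ (z : Stream' 𝓐) := Stream'.cycle_eq β hβ
  have hxz : (x : Stream' 𝓐) = α ++ₛ (z : Stream' 𝓐) := he
  have hct : coef R hX x x t = T β.length := by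
    rw [coef_apply, ht, map_mul, map_mul, Module.End.mul_apply, Module.End.mul_apply,
      rep_ss_append hX α _ hxz, rep_ss_append hX β _ hzz, rep_sd, ← hxz, extend_coe,
      Pi.single_eq_same, mul_one, ← LaurentPolynomial.T_add, ← LaurentPolynomial.T_add]
    congr 1
    ring
  have hc1 : coef R hX x x 1 = 1 := by
    rw [coef_apply, map_one, Module.End.one_apply, Pi.single_eq_same]
  have hpos := List.length_pos_iff.2 hβ
  have hne : (1 : R[T;T⁻¹]) - T β.length ≠ 0 := by
    intro h0
    have h1 := congrArg (fun g : R[T;T⁻¹] => g.coeff 0) (sub_eq_zero.1 h0)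
    rw [← LaurentPolynomial.T_zero, LaurentPolynomial.T_apply, LaurentPolynomial.T_apply,
      if_pos rfl, if_neg (by omega)] at h1
    exact one_ne_zero h1
  have hpt : ∀ c, coef R hX x x (pp R X {x} * c) = coef R hX x x c := by
    intro c
    rw [coef_apply, coef_apply, map_mul, Module.End.mul_apply, rep_pp hX hx,
      if_pos (Set.mem_singleton x)]
  have hud : coef R hX x x (pp R X {x} * (1 - t) * d) =
      (1 - T β.length) * coef R hX x x d := by
    rw [coef_mul_of_pt hX hx _ _ hd, hpt, map_sub, hc1, hct]
  obtain ⟨v, hv⟩ := h (pp R X {x} * (1 - t)) (by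
    intro h0
    rw [h0, map_zero] at hud
    exact mul_ne_zero hne hd0 hud.symm)
  have h1 := congrArg (coef R hX x x) hv
  rw [coef_mul_of_pt hX hx _ _ (by rw [← mul_assoc, ← mul_assoc, pp_idem hx]), hud,
    ← mul_assoc] at h1
  have h2 : coef R hX x x v * (1 - T β.length) = 1 :=
    mul_right_cancel₀ hd0 (h1.trans (one_mul _).symm)
  -- At `T = 1` the factor `1 - T^|β|` vanishes, so the equation becomes `0 = 1`.
  have h3 := congrArg (LaurentPolynomial.eval₂ (RingHom.id R) 1) h2
  rw [map_mul, map_sub, map_one, LaurentPolynomial.eval₂_T] at h3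
  simp at h3

theorem exists_aperiodic_of_isAtom {L : Ideal (Alg R X)} (hL : IsAtom L) :
    ∃ x : X, {x} ∈ boolAlg X ∧ IsAperiodic (x : Stream' 𝓐) ∧
      L ≤ (TwoSidedIdeal.span {pp R X {x}}).asIdeal := by
  classical
  obtain ⟨a, haL, ha⟩ := (Submodule.ne_bot_iff L).1 hL.1
  have hmin : ∀ u ∈ L, u ≠ 0 → ∀ w ∈ L, ∃ v, v * u = w := by
    intro u huL hu w hw
    have : Ideal.span {u} = L :=
      (hL.le_iff.1 ((Ideal.span_singleton_le_iff_mem L).2 huL)).resolve_left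
        fun h0 => hu (Ideal.span_singleton_eq_bot.1 h0)
    rw [← this] at hw
    exact Ideal.mem_span_singleton'.1 hw
  obtain ⟨b, c, hbc⟩ := exists_reduction (R := R) hX ha
  -- The product `b a c` need not lie in `L`, but `b a` does; minimality is used there, and the
  -- result is multiplied by `c` on the right.
  have hinv : ∀ u, u * (b * a * c) ≠ 0 → ∃ v, v * (u * (b * a * c)) = b * a * c := by
    intro u hu
    obtain ⟨v, hv⟩ := hmin (u * (b * a)) (L.mul_mem_left _ (L.mul_mem_left _ haL))
      (fun h0 => hu (by rw [← mul_assoc, h0, zero_mul])) _ (L.mul_mem_left b haL)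
    exact ⟨v, by rw [← mul_assoc, ← mul_assoc, mul_assoc v, hv]⟩
  obtain ⟨x, hxU, hx1, hx0⟩ : ∃ x : X, {x} ∈ boolAlg X ∧ pp R X {x} * (b * a * c) = b * a * c ∧
      coef R hX x x (b * a * c) ≠ 0 := by
    rcases hbc with ⟨E, hE, ⟨x, hx⟩, r, hr, he⟩ | ⟨x, hxU, h1, h2, h3⟩
    -- A second point `y` of `E` is separated from `x` by a cylinder `Z` around `x`. Minimality
    -- recovers `r p_E` from `p_Z (r p_E)`, and right multiplication by the projection of the
    -- complement of `Z` then kills a nonzero element.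
    · have hEx : E = {x} := by
        refine Set.eq_singleton_iff_unique_mem.2 ⟨hx, fun y hy => ?_⟩
        by_contra hne
        obtain ⟨n, hn⟩ := exists_notMem_cyl hX hne
        have hZ := cyl_mem_boolAlg hX x n
        have hZ' := BooleanSubalgebra.compl_mem hZ
        rw [he] at hinv
        have hD : pp R X (cyl X x n) * (r • pp R X E) = r • pp R X (cyl X x n ∩ E) := by
          rw [mul_smul_comm, pp_inter hZ hE]
        obtain ⟨v, hv⟩ := hinv (pp R X (cyl X x n)) (by
          rw [hD]
          exact smul_ne_zero hr
            (pp_ne_zero hX (inter_mem_boolAlg hZ hE) ⟨x, self_mem_cyl hX _ _, hx⟩))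
        refine smul_ne_zero hr (pp_ne_zero (R := R) hX (inter_mem_boolAlg hE hZ') ⟨y, hy, hn⟩) ?_
        rw [pp_inter hE hZ', ← smul_mul_assoc, ← hv, mul_assoc, mul_assoc, smul_mul_assoc,
          pp_comm hE hZ', mul_smul_comm, ← mul_assoc (pp R X (cyl X x n)), ← pp_inter hZ hZ',
          Set.inter_compl_self, pp_empty, zero_mul, smul_zero, mul_zero]
      subst hEx
      refine ⟨x, hE, by rw [he, mul_smul_comm, pp_idem hE], ?_⟩
      rw [he, map_smul, coef_apply, rep_pp hX hE, if_pos (Set.mem_singleton x),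
        Pi.single_eq_same]
      intro h0
      have h1 := congrArg (fun g : R[T;T⁻¹] => g.coeff 0) h0
      rw [← LaurentPolynomial.T_zero] at h1
      simp at h1
      exact hr h1
    · exact ⟨x, hxU, h1, h3⟩
  refine ⟨x, hxU, isAperiodic_of_left_inverse hX hxU hx1 hx0 hinv, fun w hw => ?_⟩
  -- The element `p_{x} b a` of `L` is nonzero, as `p_{x} b a c = b a c` is, so it generates `L`.
  obtain ⟨v, rfl⟩ := hmin (pp R X {x} * (b * a)) (L.mul_mem_left _ (L.mul_mem_left _ haL))
    (fun h0 => hx0 (by rw [← hx1, ← mul_assoc, h0, zero_mul, map_zero])) w hw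
  rw [TwoSidedIdeal.mem_asIdeal]
  exact TwoSidedIdeal.mul_mem_left _ _ _ (TwoSidedIdeal.mul_mem_right _ _ _
    (TwoSidedIdeal.subset_span rfl))

end

/-! ### The socle -/

theorem isFull_subshift {F : Set (List 𝓐)} (h : (subshift F).Nonempty)
    (hF : ∀ a : 𝓐, [a] ∈ language (subshift F)) : IsFull (subshift F) where
  tail_mem := fun _ hx m n => hx (m + 1) n
  nil_mem := h.elim fun x hx => ⟨x, hx, 0, rfl⟩
  letter_mem := hF

theorem subsingleton_alg {R : Type v} [CommRing R] (h : ¬ X.Nonempty) :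
    Subsingleton (Alg R X) := by
  have : (Set.univ : Set X) = ∅ := Set.eq_empty_of_forall_notMem fun x => (h ⟨x, x.2⟩).elim
  exact subsingleton_of_zero_eq_one (by rw [← pp_univ, this, pp_empty])

theorem pointIdeal_eq {R : Type v} [CommRing R] (x : X) (hx : {x} ∈ boolAlg X) :
    pointIdeal R X x hx = TwoSidedIdeal.span {pp R X {x}} := by
  rw [pointIdeal, pp_of_mem hx]

end

end SubshiftAlgebra

end

theorem mainTheorem5 {𝓐 : Type*} {R : Type*} [Field R] (F : Set (List 𝓐))
    (hF : (SubshiftAlgebra.subshift F).Nonempty →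
      ∀ a : 𝓐, [a] ∈ SubshiftAlgebra.language (SubshiftAlgebra.subshift F)) :
    (∀ (x y : SubshiftAlgebra.subshift F)
        (hx : ({x} : Set (SubshiftAlgebra.subshift F)) ∈
          SubshiftAlgebra.boolAlg (SubshiftAlgebra.subshift F))
        (hy : ({y} : Set (SubshiftAlgebra.subshift F)) ∈
          SubshiftAlgebra.boolAlg (SubshiftAlgebra.subshift F)),
      (SubshiftAlgebra.TailEquiv (x : Stream' 𝓐) (y : Stream' 𝓐) →
        SubshiftAlgebra.pointIdeal R (SubshiftAlgebra.subshift F) x hx =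
          SubshiftAlgebra.pointIdeal R (SubshiftAlgebra.subshift F) y hy) ∧
      (¬ SubshiftAlgebra.TailEquiv (x : Stream' 𝓐) (y : Stream' 𝓐) →
        ∀ a ∈ SubshiftAlgebra.pointIdeal R (SubshiftAlgebra.subshift F) x hx,
        ∀ b ∈ SubshiftAlgebra.pointIdeal R (SubshiftAlgebra.subshift F) y hy, a * b = 0)) ∧
    (∀ rep : SubshiftAlgebra.PathClass (SubshiftAlgebra.subshift F) →
        SubshiftAlgebra.IrrationalPath (SubshiftAlgebra.subshift F),
      (∀ c, Quotient.mk (SubshiftAlgebra.tailSetoid (SubshiftAlgebra.subshift F)) (rep c) = c) →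
      iSupIndep (fun c : SubshiftAlgebra.PathClass (SubshiftAlgebra.subshift F) =>
        TwoSidedIdeal.asIdeal (SubshiftAlgebra.pointIdeal R (SubshiftAlgebra.subshift F)
          (rep c).1 (rep c).2.1)) ∧
      SubshiftAlgebra.socle (SubshiftAlgebra.Alg R (SubshiftAlgebra.subshift F)) =
        ⨆ c : SubshiftAlgebra.PathClass (SubshiftAlgebra.subshift F),
          TwoSidedIdeal.asIdeal (SubshiftAlgebra.pointIdeal R (SubshiftAlgebra.subshift F)
            (rep c).1 (rep c).2.1)) := by
  by_cases hne : (SubshiftAlgebra.subshift F).Nonempty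
  swap
  -- For the empty subshift, `1 = p_X = p_∅ = 0`, so the algebra is trivial.
  · have := SubshiftAlgebra.subsingleton_alg (R := R) hne
    exact ⟨fun x => (hne ⟨x, x.2⟩).elim, fun rep _ =>
      ⟨fun c => (hne ⟨(rep c).1, (rep c).1.2⟩).elim, Subsingleton.elim _ _⟩⟩
  have hX := SubshiftAlgebra.isFull_subshift hne (hF hne)
  have hzero : ∀ (x y : SubshiftAlgebra.subshift F)
      (hx : {x} ∈ SubshiftAlgebra.boolAlg (SubshiftAlgebra.subshift F))
      (hy : {y} ∈ SubshiftAlgebra.boolAlg (SubshiftAlgebra.subshift F)),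
      ¬ SubshiftAlgebra.TailEquiv (x : Stream' 𝓐) (y : Stream' 𝓐) →
        ∀ a ∈ SubshiftAlgebra.pointIdeal R (SubshiftAlgebra.subshift F) x hx,
        ∀ b ∈ SubshiftAlgebra.pointIdeal R (SubshiftAlgebra.subshift F) y hy, a * b = 0 := by
    intro x y hx hy h a ha b hb
    rw [SubshiftAlgebra.pointIdeal_eq] at ha hb
    exact SubshiftAlgebra.mul_eq_zero_of_mem_span
      (SubshiftAlgebra.pt_mul_mul_pt_eq_zero hX hx hy h) ha hb
  refine ⟨fun x y hx hy => ⟨fun h => ?_, hzero x y hx hy⟩, fun rep hrep => ⟨?_, ?_⟩⟩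
  · rw [SubshiftAlgebra.pointIdeal_eq, SubshiftAlgebra.pointIdeal_eq]
    exact SubshiftAlgebra.span_pt_eq_of_tailEquiv hX hx hy h
  · refine SubshiftAlgebra.iSupIndep_asIdeal _ (fun i j hij => ?_) fun i a ha => ?_
    · refine hzero _ _ _ _ fun h => hij ?_
      rw [← hrep i, ← hrep j]
      exact Quotient.sound h
    · rw [SubshiftAlgebra.pointIdeal_eq] at ha
      obtain ⟨S, hS, hSa⟩ := SubshiftAlgebra.exists_local_unit hX (rep i).2.1 ha
      refine ⟨_, ?_, hSa⟩
      rw [SubshiftAlgebra.pointIdeal_eq]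
      exact sum_mem fun x hx =>
        SubshiftAlgebra.pt_mem_span_of_tailEquiv hX (hS x hx).1 (hS x hx).2
  · apply le_antisymm
    · refine sSup_le fun L hL => ?_
      obtain ⟨x, hx, hap, hle⟩ := SubshiftAlgebra.exists_aperiodic_of_isAtom hX hL
      refine hle.trans ?_
      set q : SubshiftAlgebra.IrrationalPath (SubshiftAlgebra.subshift F) :=
        ⟨x, hx, fun α _ β _ hβ => hap α β hβ⟩
      refine le_trans (le_of_eq ?_) (le_iSup _ (Quotient.mk _ q))
      rw [SubshiftAlgebra.pointIdeal_eq, SubshiftAlgebra.span_pt_eq_of_tailEquiv hX hx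
        (rep (Quotient.mk _ q)).2.1 (Quotient.exact (hrep (Quotient.mk _ q)).symm)]
    · refine iSup_le fun c => ?_
      rw [SubshiftAlgebra.pointIdeal_eq]
      exact SubshiftAlgebra.asIdeal_span_le_socle
        (SubshiftAlgebra.exists_left_inverse_of_isAperiodic hX (rep c).2.1
          (SubshiftAlgebra.isAperiodic_of_language hX (rep c).2.2))
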